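/- Let $\mathbb F$ be a field and let $q\in\mathbb F$ be nonzero and not a root of unity. Write $[X,Y]=XY-YX$ and $[X,Y]_q=qXY-q^{-1}YX$. The $q$-Onsager algebra $\mathcal O_q$ is the associative unital $\mathbb F$-algebra with generators $A,A^*$ and relations $[A,[A,[A,A^*]_q]_{q^{-1}}]=(q^2-q^{-2})^2[A^*,A]$ and $[A^*,[A^*,[A^*,A]_q]_{q^{-1}}]=(q^2-q^{-2})^2[A,A^*]$. Let $L$ be the automorphism of $\mathcal O_q$ with $L(A)=A$ and $L(A^*)=A^*+\frac{[A,[A,A^*]_q]}{(q-q^{-1})(q^2-q^{-2})}$. Let $V$ be a finite-dimensional irreducible $\mathcal O_q$-module of dimension at least $2$ on which each of $A,A^*$ is diagonalizable. There exist an integer $d\ge 0$, an ordering $\theta_0,\dots,\theta_d$ of the eigenvalues of $A$ on $V$ in which consecutive eigenvalues $x,y$ satisfy $x^2-(q^2+q^{-2})xy+y^2+(q^2-q^{-2})^2=0$, a nonzero $a\in\mathbb F$ with $\theta_i=aq^{d-2i}+a^{-1}q^{2i-d}$ for $0\le i\le d$, and an ordering $\theta^*_0,\dots,\theta^*_d$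 of the eigenvalues of $A^*$ on $V$ such that the eigenspaces $V^*_i$ of $A^*$ for $\theta^*_i$ satisfy $AV^*_i\subseteq V^*_{i-1}+V^*_i+V^*_{i+1}$ for $0\le i\le d$ (where $V^*_{-1}=V^*_{d+1}=0$). For every such choice the following holds. Let $V_i$ be the eigenspace of $A$ for $\theta_i$ and let $V^-_i$ be the eigenspace of $L^{-1}(A^*)$ for $\theta^*_i$. A decomposition of $V$ is a sequence $\{W_i\}_{i=0}^d$ of nonzero subspaces whose direct sum is $V$; its inversion is $\{W_{d-i}\}_{i=0}^d$. For decompositions $X=\{X_i\}$ and $Y=\{Y_i\}$ of $V$ and $M\in\mathrm{End}(V)$, write $M:X\to Y$ if the eigenspaces $W_i$ of $M$ for $q^{d-2i}$ $(0\le i\le d)$ form a decomposition of $V$ such that $W_0+\cdots+W_i=X_0+\cdots+X_i$ and $W_d+W_{d-1}+\cdots+W_{d-i}=Y_0+\cdots+Y_i$ for $0\le i\le d$. Then $X=\{V_i\}$, $X^*=\{V^*_i\}$, $X^-=\{V^-_i\}$ are decompositions of $V$; denote their inversions by $\overline X,\overline{X^*},\overline{X^-}$. Moreover $a\ne a^{-1}$,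 there exist $K,B,K^\downarrow,B^\downarrow\in\mathrm{End}(V)$ with $$K:X^*\to\overline X,\qquad B:X^*\to X,\qquad K^\downarrow:\overline{X^*}\to\overline X,\qquad B^\downarrow:\overline{X^*}\to X,$$ and for any such maps $$a^{-1}A-a^{-2}B:X\to X^-,\qquad aA-a^2K:\overline X\to X^-,$$ $$a^{-1}A-a^{-2}B^\downarrow:X\to\overline{X^-},\qquad aA-a^2K^\downarrow:\overline X\to\overline{X^-},$$ $$\frac{aK-a^{-1}B}{a-a^{-1}}:X^*\to X^-,\qquad \frac{aK^\downarrow-a^{-1}B^\downarrow}{a-a^{-1}}:\overline{X^*}\to\overline{X^-}.$$ -/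

import Mathlib

namespace QOnsager

/-- The `q`-commutator `[x, y]_q = q x y - q⁻¹ y x`. -/
def qComm {F R : Type*} [Field F] [Ring R] [Algebra F R] (q : F) (x y : R) : R :=
  q • (x * y) - q⁻¹ • (y * x)

/-- The `q`-Dolan/Grady relation for the ordered pair `x, y`:
`[x, [x, [x, y]_q]_{q⁻¹}] = (q² - q⁻²)² [y, x]`. -/
def DolanGrady {F R : Type*} [Field F] [Ring R] [Algebra F R] (q : F) (x y : R) : Prop :=
  ⁅x, qComm q⁻¹ x (qComm q x y)⁆ = (q ^ 2 - q⁻¹ ^ 2) ^ 2 • ⁅y, x⁆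

/-- `x + [a, [a, x]_q] / ((q - q⁻¹)(q² - q⁻²))` -/
def twistElt {F R : Type*} [Field F] [Ring R] [Algebra F R] (q : F) (a x : R) : R :=
  x + ((q - q⁻¹) * (q ^ 2 - q⁻¹ ^ 2))⁻¹ • ⁅a, qComm q a x⁆

/-! Auxiliary facts: the twisted generators satisfy the `q`-Dolan/Grady relations, so that the
automorphism below exists. -/

section Aux

open MvPolynomial

/-- `x₀ⁱ x₁ʲ ↦ aⁱ y aʲ`. -/
noncomputable def phi1 (F : Type*) {R : Type*} [Field F] [Ring R] [Algebra F R] (a y : R) :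
    MvPolynomial (Fin 2) F →ₗ[F] R :=
  (basisMonomials (Fin 2) F).constr F fun m => a ^ m 0 * y * a ^ m 1

/-- `x₀ⁱ x₁ʲ x₂ᵏ x₃ˡ ↦ aⁱ y aʲ y aᵏ y aˡ`. -/
noncomputable def phi3 (F : Type*) {R : Type*} [Field F] [Ring R] [Algebra F R] (a y : R) :
    MvPolynomial (Fin 4) F →ₗ[F] R :=
  (basisMonomials (Fin 4) F).constr F fun m => a ^ m 0 * y * a ^ m 1 * y * a ^ m 2 * y * a ^ m 3

variable {F R : Type*} [Field F] [Ring R] [Algebra F R] (a y : R)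

theorem phi1_monomial (m : Fin 2 →₀ ℕ) (r : F) :
    phi1 F a y (monomial m r) = r • (a ^ m 0 * y * a ^ m 1) := by
  have : monomial m r = r • basisMonomials (Fin 2) F m := by simp [smul_monomial]
  rw [this, map_smul, phi1, Module.Basis.constr_basis]

theorem phi3_monomial (m : Fin 4 →₀ ℕ) (r : F) :
    phi3 F a y (monomial m r) =
      r • (a ^ m 0 * y * a ^ m 1 * y * a ^ m 2 * y * a ^ m 3) := by
  have : monomial m r = r • basisMonomials (Fin 4) F m := by simp [smul_monomial]
  rw [this, map_smul, phi3, Module.Basis.constr_basis]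

theorem phi1_X0_mul (u : MvPolynomial (Fin 2) F) : phi1 F a y (X 0 * u) = a * phi1 F a y u := by
  induction u using MvPolynomial.induction_on' with
  | monomial m r =>
    rw [X, monomial_mul, phi1_monomial, phi1_monomial]
    simp [pow_add, mul_assoc]
  | add p q hp hq => simp [mul_add, hp, hq]

theorem phi1_X1_mul (u : MvPolynomial (Fin 2) F) : phi1 F a y (X 1 * u) = phi1 F a y u * a := by
  induction u using MvPolynomial.induction_on' with
  | monomial m r =>
    rw [X, monomial_mul, phi1_monomial, phi1_monomial]
    simp [pow_add, mul_assoc, (Commute.refl a).pow_right _ |>.eq]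
  | add p q hp hq => simp [mul_add, add_mul, hp, hq]

theorem phi1_one : phi1 F a y 1 = y := by
  have := phi1_monomial (F := F) a y 0 1
  simpa using this

theorem phi3_X0_mul (u : MvPolynomial (Fin 4) F) : phi3 F a y (X 0 * u) = a * phi3 F a y u := by
  induction u using MvPolynomial.induction_on' with
  | monomial m r =>
    rw [X, monomial_mul, phi3_monomial, phi3_monomial]
    simp [pow_add, mul_assoc]
  | add p q hp hq => simp [mul_add, hp, hq]

theorem phi3_X3_mul (u : MvPolynomial (Fin 4) F) : phi3 F a y (X 3 * u) = phi3 F a y u * a := by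
  induction u using MvPolynomial.induction_on' with
  | monomial m r =>
    rw [X, monomial_mul, phi3_monomial, phi3_monomial]
    simp [pow_add, mul_assoc]
    simp only [← pow_succ, ← pow_succ']
  | add p q hp hq => simp [mul_add, add_mul, hp, hq]

/-- Substitution of two of the four variables. -/
noncomputable def sub2 (F : Type*) [Field F] (i j : Fin 4) :
    MvPolynomial (Fin 2) F →ₐ[F] MvPolynomial (Fin 4) F := aeval ![X i, X j]

theorem phi3_mul (u v w : MvPolynomial (Fin 2) F) :
    phi3 F a y (sub2 F 0 1 u * sub2 F 1 2 v * sub2 F 2 3 w) =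
      phi1 F a y u * phi1 F a y v * phi1 F a y w := by
  induction u using MvPolynomial.induction_on' with
  | add p q hp hq => simp [add_mul, hp, hq]
  | monomial m r =>
  induction v using MvPolynomial.induction_on' with
  | add p q hp hq => simp only [mul_add, add_mul, map_add, hp, hq]
  | monomial n s =>
  induction w using MvPolynomial.induction_on' with
  | add p q hp hq => simp only [mul_add, map_add, hp, hq]
  | monomial l t =>
    have key (i j : Fin 4) (m : Fin 2 →₀ ℕ) (r : F) : sub2 F i j (monomial m r) =
        monomial (Finsupp.single i (m 0) + Finsupp.single j (m 1)) r := by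
      rw [sub2, aeval_monomial, Finsupp.prod_fintype _ _ (by simp)]
      simp [Fin.prod_univ_two, X_pow_eq_monomial, monomial_mul, algebraMap_eq, C_mul_monomial]
    rw [key, key, key, monomial_mul, monomial_mul, phi3_monomial, phi1_monomial, phi1_monomial,
      phi1_monomial]
    simp [pow_add, mul_assoc, smul_smul]
    congr 1
    ring

/-- Coefficients in an explicit ideal-membership certificate. -/
def cert0 {S : Type*} [CommRing S] (q s x0 x1 x2 x3 : S) : S :=
  (q ^ 5 - q ^ 3 - q + s) * x0 ^ 2
      + (q ^ 7 - q ^ 3 - q + s ^ 3) * x0 * x2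
      + (-q ^ 7 - q ^ 5 + 2 * q ^ 3 + q - s ^ 5) * x0 * x3
      + (-q ^ 7 + q ^ 3 + q - s ^ 3) * x1 ^ 2
      + (q ^ 9 + q ^ 7 - 2 * q ^ 3 - 2 * q + s ^ 3 + s ^ 5) * x1 * x2
      + (-q ^ 7 + q ^ 3 + q - s ^ 3) * x1 * x3
      + (-q ^ 9 - q ^ 7 + q ^ 3 + 2 * q + s - s ^ 5 - s ^ 7) * x2 * x3
      + (2 * q ^ 7 - q ^ 3 - q - 2 * s + s ^ 5 + s ^ 7) * x3 ^ 2
      + (q ^ 11 - q ^ 9 - q ^ 7 + 2 * q - s ^ 5 - s ^ 7 + s ^ 9)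

/-- See `cert0`. -/
def cert1 {S : Type*} [CommRing S] (q s x0 x1 x2 x3 : S) : S :=
  (-q ^ 9 - q ^ 7 + q ^ 5 + q ^ 3 + q + s - s ^ 3 - s ^ 5) * x0 ^ 2
      + (q ^ 9 + q ^ 7 - 2 * q ^ 3 - 2 * q + s ^ 3 + s ^ 5) * x0 * x1
      + (-q ^ 9 + q + s + s ^ 3 - s ^ 5 - s ^ 7) * x0 * x2
      + (q ^ 9 + q ^ 7 - 2 * q - 2 * s + s ^ 7 + s ^ 9) * x0 * x3
      + (-q ^ 7 + q ^ 3 + q - s ^ 3) * x1 ^ 2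
      + (q ^ 7 - q - s + s ^ 7) * x1 * x2
      + (-q ^ 7 - q ^ 5 + q ^ 3 + q + s - s ^ 9) * x1 * x3
      + (-q ^ 3 + s + s ^ 3 - s ^ 7) * x2 ^ 2
      + (q ^ 5 + q ^ 3 - 2 * s - 2 * s ^ 3 + s ^ 7 + s ^ 9) * x2 * x3
      + (-q ^ 5 - q ^ 3 + q + s + s ^ 3 + s ^ 5 - s ^ 7 - s ^ 9) * x3 ^ 2
      + (-q ^ 11 + 2 * q ^ 7 + q ^ 5 - 2 * q - 2 * s + s ^ 5 + 2 * s ^ 7 - s ^ 11)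

/-- See `cert0`. -/
def cert2 {S : Type*} [CommRing S] (q s x0 x1 x2 x3 : S) : S :=
  (q ^ 7 + q ^ 5 - 2 * q - s - s ^ 3 + 2 * s ^ 7) * x0 ^ 2
      + (-q ^ 7 - q ^ 5 + q + 2 * s + s ^ 3 - s ^ 7 - s ^ 9) * x0 * x1
      + (-q ^ 3 + s + s ^ 3 - s ^ 7) * x0 * x2
      + (-q ^ 5 + s + 2 * s ^ 3 - s ^ 5 - s ^ 7) * x0 * x3
      + (q ^ 5 + q ^ 3 - 2 * s - 2 * s ^ 3 + s ^ 7 + s ^ 9) * x1 * x2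
      + (q ^ 3 - s - s ^ 3 + s ^ 7) * x1 * x3
      + (-q ^ 3 + s + s ^ 3 - s ^ 7) * x2 ^ 2
      + (q - s - s ^ 3 + s ^ 5) * x3 ^ 2
      + (q ^ 9 - q ^ 7 - q ^ 5 + 2 * s - s ^ 7 - s ^ 9 + s ^ 11)

/-- The polynomial of the first Dolan/Grady relation. -/
def hPol {S : Type*} [CommRing S] (q s x y : S) : S :=
  (x - y) * (x ^ 2 - (q ^ 2 + s ^ 2) * x * y + y ^ 2 + (q ^ 2 - s ^ 2) ^ 2)

/-- The polynomial of the second Dolan/Grady relation. -/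
def gPol {S : Type*} [CommRing S] (q s x0 x1 x2 x3 : S) : S :=
  x3 - (q ^ 2 + 1 + s ^ 2) * x2 + (q ^ 2 + 1 + s ^ 2) * x1 - x0

/-- The polynomial of the twisted generator; `e` is the inverse of the denominator. -/
def fPol {S : Type*} [CommRing S] (q s e x y : S) : S :=
  1 + e * ((x - y) * (q * x - s * y))

/-- An auxiliary polynomial. -/
def pPol {S : Type*} [CommRing S] (q s e t x y : S) : S :=
  fPol q s e x y + e * t * (hPol q s x y * (q ^ 2 * x - s ^ 2 * y))

theorem cert_scaled {K : Type*} [Field K] (q x0 x1 x2 x3 : K) (hq : q ≠ 0) :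
    let s := q⁻¹
    let c := (q - s) * (q ^ 2 - s ^ 2)
    let T := (q ^ 3 - s ^ 3) * (q ^ 4 - s ^ 4)
    let f := fun x y : K => c + (x - y) * (q * x - s * y)
    let d := fun x y : K => q * x - s * y
    (s * f x0 x1 * f x1 x2 * d x2 x3 - (q + s) * f x0 x1 * d x1 x2 * f x2 x3
        + q * d x0 x1 * f x1 x2 * f x2 x3) * T =
      (f x0 x3 * T + hPol q s x0 x3 * (q ^ 2 * x0 - s ^ 2 * x3)) * gPol q s x0 x1 x2 x3 * c
      + cert0 q s x0 x1 x2 x3 * hPol q s x0 x1 + cert1 q s x0 x1 x2 x3 * hPol q s x1 x2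
      + cert2 q s x0 x1 x2 x3 * hPol q s x2 x3 := by
  simp only [hPol, gPol, cert0, cert1, cert2]
  field_simp
  ring

theorem cert_field {K : Type*} [Field K] (q s e t x0 x1 x2 x3 : K) (hqs : q * s = 1)
    (he : e * ((q - s) * (q ^ 2 - s ^ 2)) = 1)
    (ht : t * ((q ^ 3 - s ^ 3) * (q ^ 4 - s ^ 4)) = 1) :
    s * fPol q s e x0 x1 * fPol q s e x1 x2 * (q * x2 - s * x3)
        - (q + s) * fPol q s e x0 x1 * (q * x1 - s * x2) * fPol q s e x2 x3
        + q * (q * x0 - s * x1) * fPol q s e x1 x2 * fPol q s e x2 x3 =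
      pPol q s e t x0 x3 * gPol q s x0 x1 x2 x3
      + e ^ 2 * t * (cert0 q s x0 x1 x2 x3 * hPol q s x0 x1
        + cert1 q s x0 x1 x2 x3 * hPol q s x1 x2
        + cert2 q s x0 x1 x2 x3 * hPol q s x2 x3) := by
  have hq : q ≠ 0 := by rintro rfl; simp at hqs
  obtain rfl : s = q⁻¹ := (inv_eq_of_mul_eq_one_right hqs).symm
  have key := cert_scaled q x0 x1 x2 x3 hq
  simp only at key
  set s := q⁻¹
  set c := (q - s) * (q ^ 2 - s ^ 2)
  set T := (q ^ 3 - s ^ 3) * (q ^ 4 - s ^ 4)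
  have hf (x y : K) : fPol q s e x y = e * (c + (x - y) * (q * x - s * y)) := by
    rw [fPol]; linear_combination -he
  have hp (x y : K) : pPol q s e t x y =
      e * t * ((c + (x - y) * (q * x - s * y)) * T + hPol q s x y * (q ^ 2 * x - s ^ 2 * y)) := by
    rw [pPol, hf]; linear_combination -(e * (c + (x - y) * (q * x - s * y))) * ht
  rw [hp]
  simp only [hf]
  generalize hPol q s x0 x3 = h03 at *
  generalize gPol q s x0 x1 x2 x3 = g at *
  generalize cert0 q s x0 x1 x2 x3 = c0 at *
  generalize cert1 q s x0 x1 x2 x3 = c1 at *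
  generalize cert2 q s x0 x1 x2 x3 = c2 at *
  generalize hPol q s x0 x1 = h01 at *
  generalize hPol q s x1 x2 = h12 at *
  generalize hPol q s x2 x3 = h23 at *
  generalize q * x0 - s * x1 = d01 at *
  generalize q * x1 - s * x2 = d12 at *
  generalize q * x2 - s * x3 = d23 at *
  generalize q * x0 - s * x3 = d03 at *
  clear_value c T s
  linear_combination e ^ 2 * t * key
    - e ^ 2 * (s * (c + (x0 - x1) * d01) * (c + (x1 - x2) * d12) * d23
      - (q + s) * (c + (x0 - x1) * d01) * d12 * (c + (x2 - x3) * d23)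
      + q * d01 * (c + (x1 - x2) * d12) * (c + (x2 - x3) * d23)) * ht
    + e * t * ((c + (x0 - x3) * d03) * T + h03 * (q ^ 2 * x0 - s ^ 2 * x3)) * g * he

theorem cert_domain {S : Type*} [CommRing S] [IsDomain S] (q s e t x0 x1 x2 x3 : S)
    (hqs : q * s = 1)
    (he : e * ((q - s) * (q ^ 2 - s ^ 2)) = 1)
    (ht : t * ((q ^ 3 - s ^ 3) * (q ^ 4 - s ^ 4)) = 1) :
    s * fPol q s e x0 x1 * fPol q s e x1 x2 * (q * x2 - s * x3)
        - (q + s) * fPol q s e x0 x1 * (q * x1 - s * x2) * fPol q s e x2 x3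
        + q * (q * x0 - s * x1) * fPol q s e x1 x2 * fPol q s e x2 x3 =
      pPol q s e t x0 x3 * gPol q s x0 x1 x2 x3
      + e ^ 2 * t * (cert0 q s x0 x1 x2 x3 * hPol q s x0 x1
        + cert1 q s x0 x1 x2 x3 * hPol q s x1 x2
        + cert2 q s x0 x1 x2 x3 * hPol q s x2 x3) := by
  let φ := algebraMap S (FractionRing S)
  have key := cert_field (φ q) (φ s) (φ e) (φ t) (φ x0) (φ x1) (φ x2) (φ x3)
    (by rw [← map_mul, hqs, map_one])
    (by simpa only [map_mul, map_sub, map_pow, map_one] using congrArg φ he)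
    (by simpa only [map_mul, map_sub, map_pow, map_one] using congrArg φ ht)
  apply IsFractionRing.injective S (FractionRing S)
  simp only [fPol, gPol, hPol, pPol, cert0, cert1, cert2, map_add, map_sub, map_mul, map_neg,
    map_pow, map_one, map_ofNat] at key ⊢
  exact key

theorem phi1_C_mul (r : F) (u : MvPolynomial (Fin 2) F) :
    phi1 F a y (C r * u) = r • phi1 F a y u := by
  rw [C_mul', map_smul]

theorem phi3_C_mul (r : F) (u : MvPolynomial (Fin 4) F) :
    phi3 F a y (C r * u) = r • phi3 F a y u := by
  rw [C_mul', map_smul]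

theorem phi1_mul_eq_zero {h : MvPolynomial (Fin 2) F} (hh : phi1 F a y h = 0)
    (u : MvPolynomial (Fin 2) F) : phi1 F a y (u * h) = 0 := by
  induction u using MvPolynomial.induction_on with
  | C r => rw [phi1_C_mul, hh, smul_zero]
  | add p q hp hq => rw [add_mul, map_add, hp, hq, add_zero]
  | mul_X p i hp =>
    rw [mul_comm p, mul_assoc]
    fin_cases i
    · simp only [Fin.zero_eta, phi1_X0_mul, hp, mul_zero]
    · simp only [Fin.mk_one, phi1_X1_mul, hp, zero_mul]

theorem sub2_X0 (i j : Fin 4) : sub2 F i j (X 0) = X i := by simp [sub2]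

theorem sub2_X1 (i j : Fin 4) : sub2 F i j (X 1) = X j := by simp [sub2]

theorem sub2_C (i j : Fin 4) (r : F) : sub2 F i j (C r) = C r := by
  simp [sub2, algebraMap_eq]

theorem phi3_mul_eq_zero {h : MvPolynomial (Fin 2) F} (hh : phi1 F a y h = 0)
    (u : MvPolynomial (Fin 4) F) :
    phi3 F a y (u * sub2 F 0 1 h) = 0 ∧ phi3 F a y (u * sub2 F 1 2 h) = 0 ∧
      phi3 F a y (u * sub2 F 2 3 h) = 0 := by
  induction u using MvPolynomial.induction_on' with
  | add p q hp hq => simp [add_mul, hp, hq]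
  | monomial m r =>
    have hm : (monomial m r : MvPolynomial (Fin 4) F) =
        C r * (X 0 ^ m 0 * X 1 ^ m 1 * X 2 ^ m 2 * X 3 ^ m 3) := by
      rw [monomial_eq, Finsupp.prod_fintype _ _ (by simp), Fin.prod_univ_four]
    have h1 : (monomial m r * sub2 F 0 1 h : MvPolynomial (Fin 4) F) =
        sub2 F 0 1 ((C r * X 0 ^ m 0 * X 1 ^ m 1) * h) * sub2 F 1 2 (X 1 ^ m 2) *
          sub2 F 2 3 (X 1 ^ m 3) := by
      rw [hm]; simp only [map_mul, map_pow, sub2_X0, sub2_X1, sub2_C]; ring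
    have h2 : (monomial m r * sub2 F 1 2 h : MvPolynomial (Fin 4) F) =
        sub2 F 0 1 (C r * X 0 ^ m 0 * X 1 ^ m 1) * sub2 F 1 2 (X 1 ^ m 2 * h) *
          sub2 F 2 3 (X 1 ^ m 3) := by
      rw [hm]; simp only [map_mul, map_pow, sub2_X0, sub2_X1, sub2_C]; ring
    have h3 : (monomial m r * sub2 F 2 3 h : MvPolynomial (Fin 4) F) =
        sub2 F 0 1 (C r * X 0 ^ m 0 * X 1 ^ m 1) * sub2 F 1 2 (X 1 ^ m 2) *
          sub2 F 2 3 (X 1 ^ m 3 * h) := by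
      rw [hm]; simp only [map_mul, map_pow, sub2_X0, sub2_X1, sub2_C]; ring
    rw [h1, h2, h3, phi3_mul, phi3_mul, phi3_mul]
    simp [phi1_mul_eq_zero a y hh]

theorem phi3_outer {g : MvPolynomial (Fin 4) F} {k : MvPolynomial (Fin 2) F}
    (hg : phi3 F a y g = phi1 F a y k) (u : MvPolynomial (Fin 2) F) :
    phi3 F a y (sub2 F 0 3 u * g) = phi1 F a y (u * k) := by
  induction u using MvPolynomial.induction_on with
  | C r => rw [sub2_C, phi3_C_mul, phi1_C_mul, hg]
  | add p q hp hq => rw [map_add, add_mul, add_mul, map_add, map_add, hp, hq]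
  | mul_X p i hp =>
    rw [map_mul (sub2 F 0 3), mul_comm p, mul_comm (sub2 F 0 3 p), mul_assoc, mul_assoc]
    fin_cases i
    · simp only [Fin.zero_eta, sub2_X0, phi1_X0_mul, phi3_X0_mul, hp]
    · simp only [Fin.mk_one, sub2_X1, phi1_X1_mul, phi3_X3_mul, hp]

/-- `q` is not zero and not a root of unity. -/
def IsGeneric {F : Type*} [Field F] (q : F) : Prop := q ≠ 0 ∧ ∀ n : ℕ, 0 < n → q ^ n ≠ 1

theorem IsGeneric.inv {q : F} (hq : IsGeneric q) : IsGeneric q⁻¹ :=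
  ⟨inv_ne_zero hq.1, fun n hn h => hq.2 n hn (by rwa [inv_pow, inv_eq_one] at h)⟩

theorem IsGeneric.sub_ne_zero {q : F} (hq : IsGeneric q) {n : ℕ} (hn : 0 < n) :
    q ^ n - q⁻¹ ^ n ≠ 0 := by
  intro h
  apply hq.2 (n + n) (by omega)
  rw [sub_eq_zero, inv_pow] at h
  rw [pow_add]
  nth_rewrite 1 [h]
  exact inv_mul_cancel₀ (pow_ne_zero _ hq.1)

section Twist

variable {a y} {q : F}

theorem phi1_lin (u : MvPolynomial (Fin 2) F) (r s : F) :
    phi1 F a y (u * (C r * X 0 - C s * X 1)) = r • (a * phi1 F a y u) - s • (phi1 F a y u * a) := by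
  have : u * (C r * X 0 - C s * X 1) = C r * (X 0 * u) - C s * (X 1 * u) := by ring
  rw [this, map_sub, phi1_C_mul, phi1_C_mul, phi1_X0_mul, phi1_X1_mul]

theorem phi1_qComm (u : MvPolynomial (Fin 2) F) :
    qComm q a (phi1 F a y u) = phi1 F a y (u * (C q * X 0 - C q⁻¹ * X 1)) := by
  rw [phi1_lin, qComm]

theorem phi1_lie (u : MvPolynomial (Fin 2) F) :
    ⁅a, phi1 F a y u⁆ = phi1 F a y (u * (X 0 - X 1)) := by
  have := phi1_lin (a := a) (y := y) u 1 1
  simp only [C_1, one_mul, one_smul] at this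
  rw [this, Ring.lie_def]

theorem lie_eq (y : R) : ⁅a, y⁆ = phi1 F a y (X 0 - X 1) := by
  simpa only [phi1_one, one_mul] using phi1_lie (F := F) (a := a) (y := y) 1

theorem lie_eq_neg (y : R) : ⁅y, a⁆ = - phi1 F a y (X 0 - X 1) := by
  rw [← lie_eq, Ring.lie_def, Ring.lie_def, neg_sub]

theorem phi1_lie_neg (u : MvPolynomial (Fin 2) F) :
    ⁅phi1 F a y u, a⁆ = - phi1 F a y (u * (X 0 - X 1)) := by
  rw [← phi1_lie, Ring.lie_def, Ring.lie_def, neg_sub]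

theorem qComm_eq (y : R) : qComm q a y = phi1 F a y (C q * X 0 - C q⁻¹ * X 1) := by
  simpa only [phi1_one, one_mul] using phi1_qComm (a := a) (y := y) (q := q) 1

theorem phi1_twist (u : MvPolynomial (Fin 2) F) :
    twistElt q a (phi1 F a y u) = phi1 F a y
      (u * fPol (C q) (C q⁻¹) (C ((q - q⁻¹) * (q ^ 2 - q⁻¹ ^ 2))⁻¹) (X 0) (X 1)) := by
  rw [twistElt, phi1_qComm, phi1_lie, ← phi1_C_mul, ← map_add, fPol]
  congr 1
  ring

theorem twistElt_eq (y : R) : twistElt q a y = phi1 F a y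
    (fPol (C q) (C q⁻¹) (C ((q - q⁻¹) * (q ^ 2 - q⁻¹ ^ 2))⁻¹) (X 0) (X 1)) := by
  simpa only [phi1_one, one_mul] using phi1_twist (a := a) (y := y) (q := q) 1

theorem C_mul_C_inv (σ : Type*) (hq : q ≠ 0) :
    (C q * C q⁻¹ : MvPolynomial σ F) = 1 := by
  rw [← C_mul, mul_inv_cancel₀ hq, C_1]

theorem dolanGrady_iff (hq : q ≠ 0) :
    DolanGrady q a y ↔ phi1 F a y (hPol (C q) (C q⁻¹) (X 0) (X 1)) = 0 := by
  have e1 : ⁅a, qComm q⁻¹ a (qComm q a y)⁆ = phi1 F a y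
      ((C q * X 0 - C q⁻¹ * X 1) * (C q⁻¹ * X 0 - C q * X 1) * (X 0 - X 1)) := by
    rw [qComm_eq y, phi1_qComm, phi1_lie, inv_inv]
  rw [DolanGrady, e1, lie_eq_neg (F := F), smul_neg, ← sub_eq_zero, sub_neg_eq_add, ← phi1_C_mul, ← map_add]
  have h := C_mul_C_inv (Fin 2) hq
  suffices H : (C q * X 0 - C q⁻¹ * X 1) * (C q⁻¹ * X 0 - C q * X 1) * (X 0 - X 1)
      + C ((q ^ 2 - q⁻¹ ^ 2) ^ 2) * (X 0 - X 1)
      = hPol (C q) (C q⁻¹) (X 0) (X 1 : MvPolynomial (Fin 2) F) by rw [H]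
  rw [hPol]
  simp only [map_pow, map_sub]
  linear_combination (X 0 - X 1) * (X 0 ^ 2 + X 1 ^ 2) * h

theorem dolanGrady_symm_iff (hq : q ≠ 0) :
    DolanGrady q y a ↔ phi3 F a y (gPol (C q) (C q⁻¹) (X 0) (X 1) (X 2) (X 3)) =
      phi1 F a y (C ((q ^ 2 - q⁻¹ ^ 2) ^ 2) * (X 0 - X 1)) := by
  have e2 : phi1 F a y (C ((q ^ 2 - q⁻¹ ^ 2) ^ 2) * (X 0 - X 1)) =
      (q ^ 2 - q⁻¹ ^ 2) ^ 2 • ⁅a, y⁆ := by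
    rw [phi1_C_mul, lie_eq (F := F)]
  have key (i j k l : ℕ) : phi3 F a y (X 0 ^ i * X 1 ^ j * X 2 ^ k * X 3 ^ l) =
      a ^ i * y * a ^ j * y * a ^ k * y * a ^ l := by
    have := phi3_mul (F := F) a y (X 0 ^ i * X 1 ^ j) (X 1 ^ k) (X 1 ^ l)
    simp only [map_mul, map_pow, sub2_X0, sub2_X1] at this
    rw [this]
    have e (i j : ℕ) : phi1 F a y (X 0 ^ i * X 1 ^ j) = a ^ i * y * a ^ j := by
      have : (X 0 ^ i * X 1 ^ j : MvPolynomial (Fin 2) F) =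
          monomial (Finsupp.single 0 i + Finsupp.single 1 j) 1 := by
        simp [X_pow_eq_monomial, monomial_mul]
      rw [this, phi1_monomial]; simp
    have e' (j : ℕ) : phi1 F a y (X 1 ^ j) = y * a ^ j := by simpa using e 0 j
    rw [e, e', e']
    simp only [mul_assoc]
  have x0 : phi3 F a y (X 0) = a * y * y * y := by simpa using key 1 0 0 0
  have x1 : phi3 F a y (X 1) = y * a * y * y := by simpa using key 0 1 0 0
  have x2 : phi3 F a y (X 2) = y * y * a * y := by simpa using key 0 0 1 0
  have x3 : phi3 F a y (X 3) = y * y * y * a := by simpa using key 0 0 0 1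
  have e1 : phi3 F a y (gPol (C q) (C q⁻¹) (X 0) (X 1) (X 2) (X 3)) =
      ⁅y, qComm q⁻¹ y (qComm q y a)⁆ := by
    have : gPol (C q) (C q⁻¹) (X 0) (X 1) (X 2) (X 3) =
        (X 3 - C (q ^ 2 + 1 + q⁻¹ ^ 2) * X 2 + C (q ^ 2 + 1 + q⁻¹ ^ 2) * X 1 - X 0 :
          MvPolynomial (Fin 4) F) := by
      simp only [gPol, map_add, map_pow, map_one]
    rw [this, map_sub, map_add, map_sub, phi3_C_mul, phi3_C_mul, x0, x1, x2, x3, Ring.lie_def]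
    simp only [qComm, mul_sub, sub_mul, smul_sub, inv_inv, mul_smul_comm, smul_mul_assoc,
      smul_smul, mul_assoc]
    match_scalars <;> field_simp <;> ring
  rw [e1, e2, DolanGrady]

theorem dolanGrady_twist (hq : IsGeneric q) (h1 : DolanGrady q a y) :
    DolanGrady q a (twistElt q a y) := by
  rw [dolanGrady_iff hq.1] at h1
  have e1 : ⁅a, qComm q⁻¹ a (qComm q a (twistElt q a y))⁆
      - (q ^ 2 - q⁻¹ ^ 2) ^ 2 • ⁅twistElt q a y, a⁆ = phi1 F a y
      (fPol (C q) (C q⁻¹) (C ((q - q⁻¹) * (q ^ 2 - q⁻¹ ^ 2))⁻¹) (X 0) (X 1)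
        * hPol (C q) (C q⁻¹) (X 0) (X 1)) := by
    rw [twistElt_eq, phi1_qComm, phi1_qComm, phi1_lie, phi1_lie_neg, inv_inv, smul_neg,
      sub_neg_eq_add, ← phi1_C_mul, ← map_add]
    congr 1
    have h := C_mul_C_inv (Fin 2) hq.1
    generalize fPol (C q) (C q⁻¹) (C ((q - q⁻¹) * (q ^ 2 - q⁻¹ ^ 2))⁻¹) (X 0)
      (X 1 : MvPolynomial (Fin 2) F) = f
    rw [hPol]
    simp only [map_pow, map_sub]
    linear_combination f * (X 0 - X 1) * (X 0 ^ 2 + X 1 ^ 2) * h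
  rw [DolanGrady, ← sub_eq_zero, e1, phi1_mul_eq_zero a y h1]

theorem dolanGrady_twist_symm (hq : IsGeneric q) (h1 : DolanGrady q a y)
    (h2 : DolanGrady q y a) : DolanGrady q (twistElt q a y) a := by
  have hP := (dolanGrady_iff hq.1).1 h1
  have hG := (dolanGrady_symm_iff hq.1).1 h2
  set e : F := ((q - q⁻¹) * (q ^ 2 - q⁻¹ ^ 2))⁻¹ with he_def
  set t : F := ((q ^ 3 - q⁻¹ ^ 3) * (q ^ 4 - q⁻¹ ^ 4))⁻¹ with ht_def
  have n1 : q - q⁻¹ ≠ 0 := by simpa using hq.sub_ne_zero one_pos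
  have n2 := hq.sub_ne_zero two_pos
  have n3 := hq.sub_ne_zero three_pos
  have n4 := hq.sub_ne_zero four_pos
  have he : e * ((q - q⁻¹) * (q ^ 2 - q⁻¹ ^ 2)) = 1 := inv_mul_cancel₀ (mul_ne_zero n1 n2)
  have ht : t * ((q ^ 3 - q⁻¹ ^ 3) * (q ^ 4 - q⁻¹ ^ 4)) = 1 := inv_mul_cancel₀ (mul_ne_zero n3 n4)
  set f : MvPolynomial (Fin 2) F := fPol (C q) (C q⁻¹) (C e) (X 0) (X 1) with hf
  set d : MvPolynomial (Fin 2) F := C q * X 0 - C q⁻¹ * X 1 with hd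
  have hx : twistElt q a y = phi1 F a y f := by
    rw [twistElt_eq]
  -- the key relation `[x, a]_q = [a, y]_q`
  have hD : qComm q (twistElt q a y) a = phi1 F a y d := by
    have e1 : qComm q (twistElt q a y) a = phi1 F a y (f * (C (-q⁻¹) * X 0 - C (-q) * X 1)) := by
      rw [phi1_lin, ← hx, qComm, neg_smul, neg_smul]; abel
    rw [e1, ← sub_eq_zero, ← map_sub]
    have : f * (C (-q⁻¹) * X 0 - C (-q) * X 1) - d =
        (-C e) * hPol (C q) (C q⁻¹) (X 0) (X 1) := by
      have h := C_mul_C_inv (Fin 2) hq.1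
      have he' : C e * ((C q - C q⁻¹) * (C q ^ 2 - C q⁻¹ ^ 2)) =
          (1 : MvPolynomial (Fin 2) F) := by
        simpa only [map_mul, map_sub, map_pow, map_one] using
          congrArg (C : F →+* MvPolynomial (Fin 2) F) he
      rw [hf, hd, fPol, hPol, C_neg, C_neg]
      linear_combination (X 0 - X 1) * (C q + C q⁻¹) * he'
        - C e * (X 0 - X 1) * (X 0 ^ 2 + X 1 ^ 2) * h
    rw [this]
    exact phi1_mul_eq_zero a y hP _
  have hL : ⁅twistElt q a y, qComm q⁻¹ (twistElt q a y) (qComm q (twistElt q a y) a)⁆ =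
      phi3 F a y (C q⁻¹ * (sub2 F 0 1 f * sub2 F 1 2 f * sub2 F 2 3 d)
        - C (q + q⁻¹) * (sub2 F 0 1 f * sub2 F 1 2 d * sub2 F 2 3 f)
        + C q * (sub2 F 0 1 d * sub2 F 1 2 f * sub2 F 2 3 f)) := by
    rw [map_add, map_sub, phi3_C_mul, phi3_C_mul, phi3_C_mul, phi3_mul, phi3_mul, phi3_mul, hD, hx,
      Ring.lie_def, qComm, inv_inv]
    simp only [mul_sub, sub_mul, mul_smul_comm, smul_mul_assoc, mul_assoc]
    module
  have hC := cert_domain (S := MvPolynomial (Fin 4) F) (C q) (C q⁻¹) (C e) (C t) (X 0) (X 1) (X 2)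
    (X 3) (C_mul_C_inv _ hq.1)
    (by simpa only [map_mul, map_sub, map_pow, map_one] using
          congrArg (C : F →+* MvPolynomial (Fin 4) F) he)
    (by simpa only [map_mul, map_sub, map_pow, map_one] using
          congrArg (C : F →+* MvPolynomial (Fin 4) F) ht)
  have sf (i j : Fin 4) : sub2 F i j f = fPol (C q) (C q⁻¹) (C e) (X i) (X j) := by
    simp only [hf, fPol, map_add, map_sub, map_mul, map_one, sub2_X0, sub2_X1, sub2_C]
  have sd (i j : Fin 4) : sub2 F i j d = C q * X i - C q⁻¹ * X j := by
    simp only [hd, map_sub, map_mul, sub2_X0, sub2_X1, sub2_C]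
  have sh (i j : Fin 4) : sub2 F i j (hPol (C q) (C q⁻¹) (X 0) (X 1)) =
      hPol (C q) (C q⁻¹) (X i) (X j) := by
    simp only [hPol, map_add, map_sub, map_mul, map_pow, sub2_X0, sub2_X1, sub2_C]
  set p : MvPolynomial (Fin 2) F := pPol (C q) (C q⁻¹) (C e) (C t) (X 0) (X 1) with hp
  have sp : sub2 F 0 3 p = pPol (C q) (C q⁻¹) (C e) (C t) (X 0) (X 3) := by
    simp only [hp, pPol, hPol, fPol, map_add, map_sub, map_mul, map_one, map_pow, sub2_X0, sub2_X1,
      sub2_C]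
  have hsum : C q⁻¹ * (sub2 F 0 1 f * sub2 F 1 2 f * sub2 F 2 3 d)
        - C (q + q⁻¹) * (sub2 F 0 1 f * sub2 F 1 2 d * sub2 F 2 3 f)
        + C q * (sub2 F 0 1 d * sub2 F 1 2 f * sub2 F 2 3 f) =
      sub2 F 0 3 p * gPol (C q) (C q⁻¹) (X 0) (X 1) (X 2) (X 3)
      + ((C e ^ 2 * C t * cert0 (C q) (C q⁻¹) (X 0) (X 1) (X 2) (X 3)) *
          sub2 F 0 1 (hPol (C q) (C q⁻¹) (X 0) (X 1))
        + (C e ^ 2 * C t * cert1 (C q) (C q⁻¹) (X 0) (X 1) (X 2) (X 3)) *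
          sub2 F 1 2 (hPol (C q) (C q⁻¹) (X 0) (X 1))
        + (C e ^ 2 * C t * cert2 (C q) (C q⁻¹) (X 0) (X 1) (X 2) (X 3)) *
          sub2 F 2 3 (hPol (C q) (C q⁻¹) (X 0) (X 1))) := by
    simp only [sf, sd, sh, sp, C_add]
    linear_combination hC
  rw [DolanGrady, hL, hsum, map_add, map_add, map_add, (phi3_mul_eq_zero a y hP _).1,
    (phi3_mul_eq_zero a y hP _).2.1, (phi3_mul_eq_zero a y hP _).2.2, add_zero, add_zero, add_zero,
    phi3_outer a y hG, hx, phi1_lie, ← phi1_C_mul, ← sub_eq_zero, ← map_sub]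
  have : p * (C ((q ^ 2 - q⁻¹ ^ 2) ^ 2) * (X 0 - X 1))
      - C ((q ^ 2 - q⁻¹ ^ 2) ^ 2) * (f * (X 0 - X 1)) =
      (C ((q ^ 2 - q⁻¹ ^ 2) ^ 2) * (X 0 - X 1) * (C e * C t) *
        (C q ^ 2 * X 0 - C q⁻¹ ^ 2 * X 1)) * hPol (C q) (C q⁻¹) (X 0) (X 1) := by
    rw [hp, pPol, ← hf]; ring
  rw [this, phi1_mul_eq_zero a y hP]

theorem DolanGrady.inv {u v : R} (h : DolanGrady q u v) : DolanGrady q⁻¹ u v := by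
  have : qComm q⁻¹⁻¹ u (qComm q⁻¹ u v) = qComm q⁻¹ u (qComm q u v) := by
    simp only [qComm, mul_sub, sub_mul, smul_sub, inv_inv, mul_smul_comm, smul_mul_assoc, smul_smul,
      mul_assoc]
    module
  rw [DolanGrady, this, h, inv_inv]
  congr 1
  ring

theorem twistElt_inv_twistElt (hq : IsGeneric q) (h1 : DolanGrady q a y) :
    twistElt q a (twistElt q⁻¹ a y) = y := by
  have hP := (dolanGrady_iff hq.1).1 h1
  have n1 : q - q⁻¹ ≠ 0 := by simpa using hq.sub_ne_zero one_pos
  have n2 := hq.sub_ne_zero two_pos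
  set e : F := ((q - q⁻¹) * (q ^ 2 - q⁻¹ ^ 2))⁻¹ with he_def
  have he : e * ((q - q⁻¹) * (q ^ 2 - q⁻¹ ^ 2)) = 1 := inv_mul_cancel₀ (mul_ne_zero n1 n2)
  have hee : ((q⁻¹ - q⁻¹⁻¹) * (q⁻¹ ^ 2 - q⁻¹⁻¹ ^ 2))⁻¹ = e := by
    rw [he_def, inv_inv]; congr 1; ring
  conv_rhs => rw [← phi1_one (F := F) a y]
  rw [twistElt_eq y, phi1_twist, hee, ← he_def, inv_inv, ← sub_eq_zero, ← map_sub]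
  have h := C_mul_C_inv (Fin 2) hq.1
  have he' : C e * ((C q - C q⁻¹) * (C q ^ 2 - C q⁻¹ ^ 2)) =
      (1 : MvPolynomial (Fin 2) F) := by
    simpa only [map_mul, map_sub, map_pow, map_one] using
      congrArg (C : F →+* MvPolynomial (Fin 2) F) he
  have : fPol (C q⁻¹) (C q) (C e) (X 0) (X 1) * fPol (C q) (C q⁻¹) (C e) (X 0) (X 1) - 1 =
      (C e ^ 2 * (X 0 - X 1)) * hPol (C q) (C q⁻¹) (X 0) (X 1 : MvPolynomial (Fin 2) F) := by
    rw [fPol, fPol, hPol]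
    linear_combination (-(C e * (X 0 - X 1) ^ 2 * (C q + C q⁻¹))) * he'
      + C e ^ 2 * (X 0 - X 1) ^ 2 * (X 0 ^ 2 + X 1 ^ 2) * h
  rw [this, phi1_mul_eq_zero a y hP]

end Twist

end Aux
/-- The two defining relations, on the free algebra with generators `ι false` (for `A`) and
`ι true` (for `A*`). -/
inductive OqRel (F : Type*) [Field F] (q : F) :
    FreeAlgebra F Bool → FreeAlgebra F Bool → Prop
  | dg1 : OqRel F q
      ⁅FreeAlgebra.ι F false, qComm q⁻¹ (FreeAlgebra.ι F false)
        (qComm q (FreeAlgebra.ι F false) (FreeAlgebra.ι F true))⁆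
      ((q ^ 2 - q⁻¹ ^ 2) ^ 2 • ⁅FreeAlgebra.ι F true, FreeAlgebra.ι F false⁆)
  | dg2 : OqRel F q
      ⁅FreeAlgebra.ι F true, qComm q⁻¹ (FreeAlgebra.ι F true)
        (qComm q (FreeAlgebra.ι F true) (FreeAlgebra.ι F false))⁆
      ((q ^ 2 - q⁻¹ ^ 2) ^ 2 • ⁅FreeAlgebra.ι F false, FreeAlgebra.ι F true⁆)

/-- The `q`-Onsager algebra: generators `A`, `A*`, subject to the `q`-Dolan/Grady relations. -/
abbrev Oq (F : Type*) [Field F] (q : F) : Type _ := RingQuot (OqRel F q)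

namespace Oq

variable {F : Type*} [Field F] (q : F)

/-- The generator `A`. -/
noncomputable def A : Oq F q := RingQuot.mkAlgHom F (OqRel F q) (FreeAlgebra.ι F false)

/-- The generator `A*`. -/
noncomputable def As : Oq F q := RingQuot.mkAlgHom F (OqRel F q) (FreeAlgebra.ι F true)

end Oq

theorem map_qComm {F R S : Type*} [Field F] [Ring R] [Algebra F R] [Ring S] [Algebra F S]
    (φ : R →ₐ[F] S) (q : F) (x y : R) : φ (qComm q x y) = qComm q (φ x) (φ y) := by
  simp [qComm]

theorem map_lieBr {F R S : Type*} [Field F] [Ring R] [Algebra F R] [Ring S] [Algebra F S]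
    (φ : R →ₐ[F] S) (x y : R) : φ ⁅x, y⁆ = ⁅φ x, φ y⁆ := by
  simp [Ring.lie_def]

theorem map_twistElt {F R S : Type*} [Field F] [Ring R] [Algebra F R] [Ring S] [Algebra F S]
    (φ : R →ₐ[F] S) (q : F) (x y : R) : φ (twistElt q x y) = twistElt q (φ x) (φ y) := by
  simp [twistElt, map_qComm, map_lieBr]

namespace Oq

variable {F : Type*} [Field F] {q : F}

theorem dolanGrady : DolanGrady q (A q) (As q) := by
  have := RingQuot.mkAlgHom_rel F (OqRel.dg1 (q := q))
  simp only [map_lieBr, map_qComm, map_smul] at this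
  exact this

theorem dolanGrady_symm : DolanGrady q (As q) (A q) := by
  have := RingQuot.mkAlgHom_rel F (OqRel.dg2 (q := q))
  simp only [map_lieBr, map_qComm, map_smul] at this
  exact this

/-- Two elements satisfying the `q`-Dolan/Grady relations define a homomorphism. -/
noncomputable def lift {R : Type*} [Ring R] [Algebra F R] (x y : R) (h1 : DolanGrady q x y)
    (h2 : DolanGrady q y x) : Oq F q →ₐ[F] R :=
  RingQuot.liftAlgHom F ⟨FreeAlgebra.lift F fun b => cond b y x, by
    rintro _ _ (_ | _)
    · simpa [map_lieBr, map_qComm, DolanGrady] using h1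
    · simpa [map_lieBr, map_qComm, DolanGrady] using h2⟩

section lift
variable {R : Type*} [Ring R] [Algebra F R] (x y : R) (h1 : DolanGrady q x y)
    (h2 : DolanGrady q y x)

theorem lift_A : lift x y h1 h2 (A q) = x := by simp [lift, A]

theorem lift_As : lift x y h1 h2 (As q) = y := by simp [lift, As]

end lift

theorem hom_ext {R : Type*} [Ring R] [Algebra F R] {φ ψ : Oq F q →ₐ[F] R}
    (h1 : φ (A q) = ψ (A q)) (h2 : φ (As q) = ψ (As q)) : φ = ψ := by
  apply RingQuot.ringQuot_ext'
  apply FreeAlgebra.hom_ext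
  funext b
  cases b
  · exact h1
  · exact h2

/-- The Lusztig automorphism: `L(A) = A`,
`L(A*) = A* + [A, [A, A*]_q] / ((q - q⁻¹)(q² - q⁻²))`. -/
noncomputable def lusztig (hq : IsGeneric q) : Oq F q ≃ₐ[F] Oq F q :=
  AlgEquiv.ofAlgHom
    (lift (A q) (twistElt q (A q) (As q)) (dolanGrady_twist hq dolanGrady)
      (dolanGrady_twist_symm hq dolanGrady dolanGrady_symm))
    (lift (A q) (twistElt q⁻¹ (A q) (As q))
      (by simpa using (dolanGrady_twist hq.inv dolanGrady.inv).inv)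
      (by simpa using (dolanGrady_twist_symm hq.inv dolanGrady.inv dolanGrady_symm.inv).inv))
    (by
      apply hom_ext
      · simp [lift_A]
      · simp only [AlgHom.comp_apply, lift_As, map_twistElt, lift_A, AlgHom.id_apply]
        simpa using twistElt_inv_twistElt hq.inv dolanGrady.inv)
    (by
      apply hom_ext
      · simp [lift_A]
      · simp only [AlgHom.comp_apply, lift_As, map_twistElt, lift_A, AlgHom.id_apply]
        exact twistElt_inv_twistElt hq dolanGrady)

theorem lusztig_A (hq : IsGeneric q) : lusztig hq (A q) = A q := lift_A ..

theorem lusztig_As (hq : IsGeneric q) : lusztig hq (As q) = twistElt q (A q) (As q) := lift_As ..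

theorem lusztig_symm_As (hq : IsGeneric q) :
    (lusztig hq).symm (As q) = twistElt q⁻¹ (A q) (As q) := lift_As ..

end Oq

/-! Linear algebra on a module `V`. -/

section Decompositions

variable {F V : Type*} [Field F] [AddCommGroup V] [Module F V]

/-- `M` is diagonalizable: its eigenspaces span `V`. -/
def IsDiagonalizable (M : Module.End F V) : Prop := ⨆ μ : F, M.eigenspace μ = ⊤

/-- A decomposition of `V`: nonzero subspaces `W 0, …, W d` whose direct sum is `V`. -/
def IsDecomposition {d : ℕ} (W : Fin (d + 1) → Submodule F V) : Prop :=
  (∀ i, W i ≠ ⊥) ∧ DirectSum.IsInternal W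

/-- The inversion `W d, …, W 0`. -/
def inversion {d : ℕ} (W : Fin (d + 1) → Submodule F V) : Fin (d + 1) → Submodule F V :=
  fun i => W i.rev

/-- The sequence of partial sums `i ↦ W 0 + ⋯ + W i`. Two decompositions are drawn with a common
initial vertex when these sequences agree. -/
def partialSums {d : ℕ} (W : Fin (d + 1) → Submodule F V) : Fin (d + 1) → Submodule F V :=
  fun i => ⨆ j : Fin (d + 1), ⨆ _ : j ≤ i, W j

/-- The eigenspaces of `M` for the scalars `θ 0, …, θ d`, in this order. -/
def eigenspaces {d : ℕ} (M : Module.End F V) (θ : Fin (d + 1) → F) :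
    Fin (d + 1) → Submodule F V :=
  fun i => M.eigenspace (θ i)

/-- The eigenspaces `W 0, …, W d` of `M` for the scalars `q ^ d, q ^ (d - 2), …, q ^ (-d)`. When they
form a decomposition of `V`, `M` is the map corresponding to that decomposition. -/
def mapEigenspaces (d : ℕ) (q : F) (M : Module.End F V) : Fin (d + 1) → Submodule F V :=
  eigenspaces M fun i => q ^ ((d : ℤ) - 2 * (i : ℤ))

/-- `M` labels an arrow of a diagram: `M` is the map corresponding to a decomposition
`W 0, …, W d` of `V`, and the arrow runs from the initial vertex of the decomposition `X` to the
initial vertex of the decomposition `Y`, that is,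
`W 0 + ⋯ + W i = X 0 + ⋯ + X i` and `W d + ⋯ + W (d - i) = Y 0 + ⋯ + Y i` for all `i`. -/
def IsArrow {d : ℕ} (q : F) (M : Module.End F V) (X Y : Fin (d + 1) → Submodule F V) : Prop :=
  IsDecomposition (mapEigenspaces d q M) ∧
    partialSums (mapEigenspaces d q M) = partialSums X ∧
    partialSums (inversion (mapEigenspaces d q M)) = partialSums Y

/-- The maps `K`, `B`, `K↓`, `B↓` attached to the eigenspace decompositions `X` of `A` and `Xs`
of `A*`. -/
structure IsSplitMaps {d : ℕ} (q : F) (X Xs : Fin (d + 1) → Submodule F V)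
    (K B Kd Bd : Module.End F V) : Prop where
  arrow_K : IsArrow q K Xs (inversion X)
  arrow_B : IsArrow q B Xs X
  arrow_Kd : IsArrow q Kd (inversion Xs) (inversion X)
  arrow_Bd : IsArrow q Bd (inversion Xs) X

end Decompositions

section Standard

variable {F V : Type*} [Field F] [AddCommGroup V] [Module F V]

/-- `θ 0, …, θ d` is an ordering of the eigenvalues of `M`. -/
def IsEigenvalueOrdering {d : ℕ} (M : Module.End F V) (θ : Fin (d + 1) → F) : Prop :=
  Function.Injective θ ∧ ∀ μ : F, M.HasEigenvalue μ ↔ ∃ i, θ i = μ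

/-- The polynomial `P(x, y) = x² - (q² + q⁻²) x y + y² + (q² - q⁻²)²`; distinct eigenvalues
`x`, `y` of `A` are adjacent when it vanishes. -/
def adjPoly (q x y : F) : F :=
  x ^ 2 - (q ^ 2 + q⁻¹ ^ 2) * x * y + y ^ 2 + (q ^ 2 - q⁻¹ ^ 2) ^ 2

/-- The choices made for a pair `A`, `A*` of linear maps on `V`: an ordering `θ` of the eigenvalues
of `A` in which consecutive ones are adjacent, the scalar `a` with
`θ i = a q ^ (d - 2 i) + a⁻¹ q ^ (2 i - d)`, and an ordering `θs` of the eigenvalues of `A*` such that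
`A` sends the `i`-th eigenspace of `A*` into the sum of those with index `i - 1`, `i`, `i + 1`. -/
structure IsStandard (q : F) (A As : Module.End F V) (d : ℕ) (θ θs : Fin (d + 1) → F) (a : F) :
    Prop where
  ordering : IsEigenvalueOrdering A θ
  adjacent : ∀ i j : Fin (d + 1), (j : ℕ) = (i : ℕ) + 1 → adjPoly q (θ i) (θ j) = 0
  a_ne_zero : a ≠ 0
  eigenvalue_eq : ∀ i : Fin (d + 1),
    θ i = a * q ^ ((d : ℤ) - 2 * (i : ℤ)) + a⁻¹ * q ^ (2 * (i : ℤ) - (d : ℤ))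
  ordering_star : IsEigenvalueOrdering As θs
  tridiagonal : ∀ i : Fin (d + 1), (As.eigenspace (θs i)).map A ≤
    ⨆ j : Fin (d + 1), ⨆ _ : (j : ℕ) ≤ (i : ℕ) + 1 ∧ (i : ℕ) ≤ (j : ℕ) + 1, As.eigenspace (θs j)

end Standard

/-- The action of an element of the `q`-Onsager algebra on a module `V`. -/
noncomputable def action {F : Type*} [Field F] {q : F} (V : Type*) [AddCommGroup V] [Module F V]
    [Module (Oq F q) V] [IsScalarTower F (Oq F q) V] (x : Oq F q) : Module.End F V :=
  Algebra.lsmul F F V x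

end QOnsager

open QOnsager

/-! Write λ_i = q^(d-2i). A map is an arrow between two decompositions exactly when it acts on the
successive quotients of the first flag by λ_i and on those of the second by λ_i⁻¹ (`isArrow_iff`),
because distinct scalars force the eigenspaces to reproduce the flag. Such actions add up on a fixed
flag, which settles half of each claim: on the flag of X, A acts by aλ_i + a⁻¹λ_i⁻¹ and B by λ_i⁻¹,
so N = a⁻¹A - a⁻²B acts by λ_i.

The other half concerns the flag of X⁻. The arrow B satisfies a q-Weyl type relation with each of A
and A* (`IsArrow.qWeyl`). Together with a Dolan/Grady relation these imply formally, for M =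
L⁻¹(A*), that qNM - q⁻¹MN = (q - q⁻¹)(b + b⁻¹N²), where θ*_i = bλ_i + b⁻¹λ_i⁻¹ (`qWeyl_twist`). This
makes M triangular on the reversed eigenspace flag of N, with diagonal θ*_i (`FlagScalar.of_qWeyl`).
Hence that flag is the flag of X⁻, and X⁻ is a decomposition. Reversing X and replacing a by a⁻¹
gives the statement for K; reversing X* and replacing b by b⁻¹ gives the down arrows. In aK - a⁻¹B
the terms in A cancel when K and B are expressed through the two new arrows, so the vertical maps
act by known scalars at both ends.

For existence, the Dolan/Grady relations send each eigenspace into the sum of itself and the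
adjacent ones (`mem_of_dolanGrady`). By irreducibility a maximal path of adjacent eigenvalues is the
whole spectrum, and a three-term recurrence supplies the parameters a and b. Irreducibility also
makes the flags of X and X*, in either direction, opposite (`isCompl_of_irred`), which produces the
arrows and shows that A and A* have equally many eigenvalues. -/

namespace QOnsager

/-! ### The q-Weyl relation for the twisted generator, as a formal identity. -/

section Identity

set_option maxHeartbeats 4000000 in
/-- Normal-form certificate for the commutation of `a⁻¹ A - a⁻² B` with the twisted generator. -/
theorem qWeyl_twist_certificate {F R : Type*} [Field F] [Ring R] [Algebra F R] {q a b : F}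
    (hq : q ≠ 0) (ha : a ≠ 0) (hb : b ≠ 0) {A S B r1 r2 r3 N L : R}
    (h1 : q • (B * A) - q⁻¹ • (A * B) - (q - q⁻¹) • (a⁻¹ • (B * B) + a • (1 : R)) = r1)
    (h2 : q • (S * B) - q⁻¹ • (B * S) - (q - q⁻¹) • (b • (B * B) + b⁻¹ • (1 : R)) = r2)
    (h3 : ⁅A, qComm q⁻¹ A (qComm q A S)⁆ - (q ^ 2 - q⁻¹ ^ 2) ^ 2 • ⁅S, A⁆ = r3)
    (hN : N = a⁻¹ • A - (a ^ 2)⁻¹ • B)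
    (hL : L = ((q - q⁻¹) * (q ^ 2 - q⁻¹ ^ 2)) • S + ⁅A, qComm q⁻¹ A S⁆) :
    q • (N * L) - q⁻¹ • (L * N) - ((q - q⁻¹) * ((q - q⁻¹) * (q ^ 2 - q⁻¹ ^ 2))) •
      (b • (1 : R) + b⁻¹ • (N * N)) =
      (a⁻¹) • (r3)
      + (q⁻¹ ^ 3 * a⁻¹ ^ 2) • (A * A * r2)
      + (q⁻¹ ^ 3 * a⁻¹ ^ 2 * b - q⁻¹ * a⁻¹ ^ 2 * b) • (A * r1 * B)
      + (-q⁻¹ ^ 3 * a⁻¹ ^ 2) • (A * r1 * S)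
      + (q⁻¹ ^ 3 * a⁻¹ * b - q⁻¹ * a⁻¹ ^ 3 * b⁻¹ - q⁻¹ * a⁻¹ * b + q * a⁻¹ ^ 3 * b⁻¹ - q * a⁻¹ *
        b + q ^ 3 * a⁻¹ ^ 3 * b⁻¹ + q ^ 3 * a⁻¹ * b - q ^ 5 * a⁻¹ ^ 3 * b⁻¹) • (r1)
      + (q⁻¹ * a⁻¹ ^ 2 * b - q * a⁻¹ ^ 2 * b) • (r1 * A * B)
      + (-q⁻¹ * a⁻¹ ^ 2) • (r1 * A * S)
      + (-q⁻¹ * a⁻¹ ^ 3 * b + 2 * q * a⁻¹ ^ 3 * b - q ^ 3 * a⁻¹ ^ 3 * b) • (r1 * B * B)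
      + (-q⁻¹ ^ 3 * a⁻¹ ^ 3 + q⁻¹ * a⁻¹ ^ 3) • (r1 * B * S)
      + (q⁻¹ * a⁻¹ ^ 2 + q * a⁻¹ ^ 2) • (A * S * r1)
      + (-q⁻¹ * a⁻¹ ^ 2 - q * a⁻¹ ^ 2) • (A * r2 * A)
      + (-q⁻¹ * a⁻¹ ^ 2 * b + q ^ 3 * a⁻¹ ^ 2 * b) • (r1 * B * A)
      + (q⁻¹ * a⁻¹ ^ 2 + q * a⁻¹ ^ 2) • (r1 * S * A)
      + (-q⁻¹ ^ 3 * a⁻¹ ^ 3 + q * a⁻¹ ^ 3) • (A * r2 * B)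
      + (q⁻¹ ^ 3 * a⁻¹ ^ 3 - q * a⁻¹ ^ 3) • (r1 * S * B)
      + (q * a⁻¹ ^ 2 * b - q ^ 3 * a⁻¹ ^ 2 * b) • (B * A * r1)
      + (-q * a⁻¹ ^ 2 * b + q ^ 3 * a⁻¹ ^ 2 * b) • (B * r1 * A)
      + (q⁻¹ ^ 3 * a⁻¹ ^ 3 - q⁻¹ * a⁻¹ ^ 3) • (B * r1 * S)
      + (-q⁻¹ ^ 3 * a⁻¹ ^ 3 + q * a⁻¹ ^ 3) • (B * A * r2)
      + (-q⁻¹ ^ 3 * a⁻¹ ^ 3 * b + q⁻¹ * a⁻¹ ^ 3 * b + q * a⁻¹ ^ 3 * b - q ^ 3 * a⁻¹ ^ 3 * b) • (B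
        * r1 * B)
      + (-q * a⁻¹ ^ 3 * b + 2 * q ^ 3 * a⁻¹ ^ 3 * b - q ^ 5 * a⁻¹ ^ 3 * b) • (B * B * r1)
      + (-q * a⁻¹ ^ 2) • (S * A * r1)
      + (-q ^ 3 * a⁻¹ ^ 2) • (S * r1 * A)
      + (-q * a⁻¹ ^ 3 + q ^ 3 * a⁻¹ ^ 3) • (S * r1 * B)
      + (q⁻¹ * a⁻¹ ^ 2 - q * a⁻¹ ^ 2 - q ^ 3 * a⁻¹ ^ 2 + q ^ 5 * a⁻¹ ^ 2) • (r2)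
      + (q ^ 3 * a⁻¹ ^ 2) • (r2 * A * A)
      + (-q ^ 3 * a⁻¹ ^ 3 + q ^ 5 * a⁻¹ ^ 3) • (S * B * r1)
      + (q * a⁻¹ ^ 3 - q ^ 5 * a⁻¹ ^ 3) • (r2 * B * A)
      + (q⁻¹ * a⁻¹ ^ 3 - q ^ 3 * a⁻¹ ^ 3) • (B * r2 * A)
      + (q⁻¹ * a⁻¹ ^ 4 - q * a⁻¹ ^ 4 - q ^ 3 * a⁻¹ ^ 4 + q ^ 5 * a⁻¹ ^ 4) • (r2 * B * B)
      + (q⁻¹ ^ 3 * a⁻¹ ^ 4 - q⁻¹ * a⁻¹ ^ 4 - q * a⁻¹ ^ 4 + q ^ 3 * a⁻¹ ^ 4) • (B * r2 * B) := by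
  -- Once the residuals are replaced by their definitions, both sides are noncommutative polynomials
  -- in `A`, `S`, `B`, compared monomial by monomial.
  subst h1 h2 h3 hN hL
  simp only [qComm, Ring.lie_def, mul_sub, sub_mul, mul_add, add_mul, smul_add, smul_sub, inv_inv,
    mul_smul_comm, smul_mul_assoc, smul_smul, mul_assoc, mul_one, one_mul]
  match_scalars <;> field_simp <;> ring

/-- The certificate with zero residuals. No module or eigenspace enters: the relation already
follows in any algebra. -/
theorem qWeyl_twist {F R : Type*} [Field F] [Ring R] [Algebra F R] {q a b : F}
    (hq : IsGeneric q) (ha : a ≠ 0) (hb : b ≠ 0) {A S B N : R}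
    (h1 : q • (B * A) - q⁻¹ • (A * B) = (q - q⁻¹) • (a⁻¹ • (B * B) + a • (1 : R)))
    (h2 : q • (S * B) - q⁻¹ • (B * S) = (q - q⁻¹) • (b • (B * B) + b⁻¹ • (1 : R)))
    (h3 : DolanGrady q A S) (hN : N = a⁻¹ • A - (a ^ 2)⁻¹ • B) :
    q • (N * twistElt q⁻¹ A S) - q⁻¹ • (twistElt q⁻¹ A S * N) =
      (q - q⁻¹) • (b • (1 : R) + b⁻¹ • (N * N)) := by
  have n1 : q - q⁻¹ ≠ 0 := by simpa using hq.sub_ne_zero one_pos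
  have n2 := hq.sub_ne_zero two_pos
  set D : F := (q - q⁻¹) * (q ^ 2 - q⁻¹ ^ 2) with hD
  have hD0 : D ≠ 0 := mul_ne_zero n1 n2
  -- Inverting `q` flips the sign of both factors of the denominator, so the twist at `q⁻¹` has the
  -- same denominator `D`, which is cleared here.
  have hL : D • twistElt q⁻¹ A S = D • S + ⁅A, qComm q⁻¹ A S⁆ := by
    have : (q⁻¹ - q⁻¹⁻¹) * (q⁻¹ ^ 2 - q⁻¹⁻¹ ^ 2) = D := by rw [hD, inv_inv]; ring
    rw [twistElt, this, smul_add, smul_inv_smul₀ hD0]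
  have key := qWeyl_twist_certificate hq.1 ha hb (sub_eq_zero.2 h1) (sub_eq_zero.2 h2)
    (sub_eq_zero.2 h3) hN hL
  simp only [mul_zero, zero_mul, smul_zero, add_zero] at key
  rw [sub_eq_zero] at key
  apply smul_right_injective R hD0
  simp only [mul_smul_comm, smul_mul_assoc] at key
  simp only [smul_sub, smul_comm D]
  rw [key, mul_comm, mul_smul, smul_comm]

end Identity

/-! ### Flags, and operators acting by scalars on their factors. -/

section Flags

variable {F V : Type*} [Field F] [AddCommGroup V] [Module F V] {d : ℕ}

/-- `flag W n = W 0 + ⋯ + W (n - 1)`. -/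
def flag (W : Fin (d + 1) → Submodule F V) (n : ℕ) : Submodule F V :=
  ⨆ j : Fin (d + 1), ⨆ _ : (j : ℕ) < n, W j

theorem flag_le {W : Fin (d + 1) → Submodule F V} {n : ℕ} {U : Submodule F V}
    (h : ∀ j : Fin (d + 1), (j : ℕ) < n → W j ≤ U) : flag W n ≤ U := iSup₂_le h

theorem le_flag (W : Fin (d + 1) → Submodule F V) {n : ℕ} {j : Fin (d + 1)} (h : (j : ℕ) < n) :
    W j ≤ flag W n := le_iSup₂_of_le j h le_rfl

theorem flag_zero (W : Fin (d + 1) → Submodule F V) : flag W 0 = ⊥ :=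
  eq_bot_iff.2 (flag_le fun _ h => absurd h (Nat.not_lt_zero _))

theorem flag_mono (W : Fin (d + 1) → Submodule F V) : Monotone (flag W) :=
  fun _ _ h => flag_le fun _ hj => le_flag W (hj.trans_le h)

theorem flag_eq_iSup (W : Fin (d + 1) → Submodule F V) {n : ℕ} (h : d + 1 ≤ n) :
    flag W n = ⨆ j, W j :=
  le_antisymm (flag_le fun j _ => le_iSup W j) (iSup_le fun j => le_flag W (j.2.trans_le h))

theorem flag_succ (W : Fin (d + 1) → Submodule F V) (i : Fin (d + 1)) :
    flag W (i + 1) = flag W i ⊔ W i := by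
  apply le_antisymm
  · refine flag_le fun j hj => ?_
    rcases Nat.lt_succ_iff_lt_or_eq.1 hj with h | h
    · exact (le_flag W h).trans le_sup_left
    · rw [Fin.ext h]; exact le_sup_right
  · exact sup_le (flag_mono W (Nat.le_succ _)) (le_flag W (Nat.lt_succ_self _))

theorem partialSums_eq_flag (W : Fin (d + 1) → Submodule F V) (i : Fin (d + 1)) :
    partialSums W i = flag W (i + 1) := by
  simp only [partialSums, flag, Fin.le_def, Nat.lt_succ_iff]

/-- Indexing flags by a strict bound in ℕ adds the zero subspace at the bottom and a constant tail
beyond `d + 1`; neither carries new information. -/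
theorem partialSums_eq_iff {W X : Fin (d + 1) → Submodule F V} :
    partialSums W = partialSums X ↔ flag W = flag X := by
  constructor
  · intro h
    have h1 (i : Fin (d + 1)) : flag W (i + 1) = flag X (i + 1) := by
      rw [← partialSums_eq_flag, ← partialSums_eq_flag, h]
    funext n
    rcases n with _ | n
    · rw [flag_zero, flag_zero]
    · by_cases hn : n < d + 1
      · exact h1 ⟨n, hn⟩
      · have := h1 (Fin.last d)
        rw [Fin.val_last] at this
        rw [flag_eq_iSup W (by omega), flag_eq_iSup X (by omega), ← flag_eq_iSup W le_rfl, this,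
          flag_eq_iSup X le_rfl]
  · intro h
    funext i
    rw [partialSums_eq_flag, partialSums_eq_flag, h]

theorem isDecomposition_iff {W : Fin (d + 1) → Submodule F V} :
    IsDecomposition W ↔ (∀ i, W i ≠ ⊥) ∧ iSupIndep W ∧ ⨆ i, W i = ⊤ := by
  rw [IsDecomposition, DirectSum.isInternal_submodule_iff_iSupIndep_and_iSup_eq_top]

theorem inversion_inversion (W : Fin (d + 1) → Submodule F V) : inversion (inversion W) = W := by
  funext i; simp [inversion]

theorem IsDecomposition.inversion {W : Fin (d + 1) → Submodule F V} (h : IsDecomposition W) :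
    IsDecomposition (inversion W) := by
  rw [isDecomposition_iff] at h ⊢
  refine ⟨fun i => h.1 _, h.2.1.comp Fin.rev_injective, ?_⟩
  rw [← h.2.2]
  exact Fin.revPerm.iSup_comp (g := W)

theorem IsDecomposition.flag_eq_top {W : Fin (d + 1) → Submodule F V} (h : IsDecomposition W)
    {n : ℕ} (hn : d + 1 ≤ n) : flag W n = ⊤ := by
  rw [flag_eq_iSup W hn, (isDecomposition_iff.1 h).2.2]

theorem IsDecomposition.flag_succ_ne {W : Fin (d + 1) → Submodule F V} (h : IsDecomposition W)
    (i : Fin (d + 1)) : flag W (i + 1) ≠ flag W i := by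
  intro e
  have h' := isDecomposition_iff.1 h
  apply h'.1 i
  have h1 : W i ≤ flag W i := by rw [← e]; exact le_flag W (Nat.lt_succ_self _)
  have h2 : Disjoint (W i) (flag W i) :=
    (h'.2.1 i).mono_right (flag_le fun j hj =>
      le_iSup₂_of_le j (fun e => by rw [e] at hj; exact lt_irrefl _ hj) le_rfl)
  exact h2.eq_bot_of_le h1

theorem IsDecomposition.disjoint_flag {W : Fin (d + 1) → Submodule F V} (h : IsDecomposition W)
    (n : ℕ) : Disjoint (flag W n) (flag (QOnsager.inversion W) (d + 1 - n)) := by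
  have h' := (isDecomposition_iff.1 h).2.1
  refine (h'.disjoint_biSup_biSup' (s := {j : Fin (d + 1) | (j : ℕ) < n})
    (t := {j : Fin (d + 1) | n ≤ (j : ℕ)}) ?_ (Set.toFinite _)).mono
    (flag_le fun j hj => ?_) (flag_le fun j hj => ?_)
  · rw [Set.disjoint_left]
    intro j hj hj'
    rw [Set.mem_ofPred_eq] at hj hj'
    omega
  · exact le_iSup₂_of_le (f := fun j (_ : j ∈ {j : Fin (d + 1) | (j : ℕ) < n}) => W j) j hj le_rfl
  · refine le_iSup₂_of_le (f := fun j (_ : j ∈ {j : Fin (d + 1) | n ≤ (j : ℕ)}) => W j) j.rev ?_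
      le_rfl
    rw [Set.mem_ofPred_eq, Fin.val_rev]
    omega

/-- `M` stabilizes the flag of `Y` and acts as the scalar `c i` on its `i`-th factor. -/
def FlagScalar (M : Module.End F V) (Y : Fin (d + 1) → Submodule F V) (c : Fin (d + 1) → F) :
    Prop :=
  ∀ i : Fin (d + 1), ∀ x ∈ flag Y (i + 1), M x - c i • x ∈ flag Y i

theorem FlagScalar.congr {M : Module.End F V} {X Y : Fin (d + 1) → Submodule F V}
    {c : Fin (d + 1) → F} (h : FlagScalar M X c) (e : flag X = flag Y) : FlagScalar M Y c := by
  intro i; rw [← e]; exact h i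

/-- This linearity is what allows arrows sharing a vertex to be combined, although the operators
need not commute. -/
theorem FlagScalar.linear_comb {M N : Module.End F V} {Y : Fin (d + 1) → Submodule F V}
    {c e : Fin (d + 1) → F} (h : FlagScalar M Y c) (h' : FlagScalar N Y e) (r s : F) :
    FlagScalar (r • M + s • N) Y (fun i => r * c i + s * e i) := by
  intro i x hx
  have := add_mem (Submodule.smul_mem _ r (h i x hx)) (Submodule.smul_mem _ s (h' i x hx))
  convert this using 1
  simp only [LinearMap.add_apply, LinearMap.smul_apply]
  module

theorem flagScalar_of_mem {M : Module.End F V} {Y : Fin (d + 1) → Submodule F V}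
    {c : Fin (d + 1) → F} (h : ∀ i, ∀ x ∈ Y i, M x - c i • x ∈ flag Y i) : FlagScalar M Y c := by
  intro i x hx
  have : flag Y (i + 1) ≤ (flag Y i).comap (M - algebraMap F _ (c i)) := by
    refine flag_le fun j hj y hy => ?_
    have e : (M - algebraMap F (Module.End F V) (c i)) y =
        (M y - c j • y) + (c j - c i) • y := by
      simp only [LinearMap.sub_apply, Module.algebraMap_end_apply]
      module
    rw [Submodule.mem_comap, e]
    rcases Nat.lt_succ_iff_lt_or_eq.1 hj with hj | hj
    · exact add_mem (flag_mono Y hj.le (h j y hy)) (Submodule.smul_mem _ _ (le_flag _ hj hy))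
    · obtain rfl := Fin.ext hj
      rw [sub_self, zero_smul, add_zero]
      exact h j y hy
  simpa using this hx

theorem flagScalar_eigenspaces (M : Module.End F V) (c : Fin (d + 1) → F) :
    FlagScalar M (eigenspaces M c) c :=
  flagScalar_of_mem fun i x hx => by
    rw [Module.End.mem_eigenspace_iff.1 hx, sub_self]; exact zero_mem _

/-- On a factor with scalar `c k ≠ μ` the operator `M - μ` is invertible, so a vector it kills drops
to the next lower step of the flag. -/
theorem FlagScalar.mem_flag_of_eigenvector {M : Module.End F V}
    {Y : Fin (d + 1) → Submodule F V} {c : Fin (d + 1) → F} (h : FlagScalar M Y c)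
    (hY : IsDecomposition Y) {μ : F} {x : V} (hx : M x = μ • x) {n : ℕ}
    (hc : ∀ k : Fin (d + 1), n ≤ (k : ℕ) → c k ≠ μ) : x ∈ flag Y n := by
  -- Here `m` counts the descents from the whole space; the `max` stops them at `n`.
  have key (m : ℕ) : x ∈ flag Y (max n (d + 1 - m)) := by
    induction m with
    | zero => rw [hY.flag_eq_top (by omega)]; trivial
    | succ m ih =>
      by_cases hm : n + m < d + 1
      · have h1 := h ⟨d - m, by omega⟩ x
          (by convert ih using 2; simp only; omega)
        rw [hx, ← sub_smul] at h1
        have hne : μ - c ⟨d - m, by omega⟩ ≠ 0 :=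
          sub_ne_zero.2 (hc ⟨d - m, by omega⟩ (by simp only; omega)).symm
        have := (Submodule.smul_mem_iff _ hne).1 h1
        convert this using 2
        simp only; omega
      · convert ih using 2; omega
  have := key (d + 1)
  rwa [Nat.sub_self, Nat.max_zero] at this

/-- `M - c i` is invertible on each of the eigenspaces for `c j`, `j < i`, hence surjective on their
sum. -/
theorem mem_map_flag_eigenspaces {M : Module.End F V} {c : Fin (d + 1) → F}
    (hc : Function.Injective c) (i : Fin (d + 1)) {z : V} (hz : z ∈ flag (eigenspaces M c) i) :
    ∃ y ∈ flag (eigenspaces M c) i, M y - c i • y = z := by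
  have : flag (eigenspaces M c) i ≤
      (flag (eigenspaces M c) i).map (M - algebraMap F _ (c i)) := by
    refine flag_le fun j hj y hy => ?_
    have hy' : M y = c j • y := Module.End.mem_eigenspace_iff.1 hy
    have hne : c j - c i ≠ 0 := sub_ne_zero.2 fun e => by
      rw [hc e] at hj; exact lt_irrefl _ hj
    refine ⟨(c j - c i)⁻¹ • y, Submodule.smul_mem _ _ (le_flag _ hj hy), ?_⟩
    have e : (M - algebraMap F (Module.End F V) (c i)) y = (c j - c i) • y := by
      simp [hy', sub_smul]
    rw [map_smul, e, inv_smul_smul₀ hne]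
  obtain ⟨y, hy, e⟩ := this hz
  exact ⟨y, hy, by simpa using e⟩

theorem iSupIndep_eigenspaces (M : Module.End F V) {c : Fin (d + 1) → F}
    (hc : Function.Injective c) : iSupIndep (eigenspaces M c) :=
  (Module.End.eigenspaces_iSupIndep M).comp hc

/-- A triangular operator with distinct diagonal scalars is diagonalizable, and its ordered
eigenspaces span the same flag. -/
theorem FlagScalar.flag_eigenspaces {M : Module.End F V} {Y : Fin (d + 1) → Submodule F V}
    {c : Fin (d + 1) → F} (h : FlagScalar M Y c) (hY : IsDecomposition Y)
    (hc : Function.Injective c) : flag (eigenspaces M c) = flag Y := by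
  have le1 (n : ℕ) : n ≤ d + 1 → flag Y n ≤ flag (eigenspaces M c) n := by
    induction n with
    | zero => intro _; rw [flag_zero]; exact bot_le
    | succ n ih =>
      intro hn x hx
      -- Subtracting a `y` from the lower step that absorbs the error `M x - c n • x` leaves a
      -- genuine eigenvector.
      obtain ⟨y, hy, e⟩ := mem_map_flag_eigenspaces hc ⟨n, hn⟩ (ih (by omega) (h ⟨n, hn⟩ x hx))
      have hxy : x - y ∈ eigenspaces M c ⟨n, hn⟩ := by
        rw [eigenspaces, Module.End.mem_eigenspace_iff, map_sub, smul_sub]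
        rw [sub_eq_sub_iff_add_eq_add] at e ⊢
        rw [← e, add_comm]
      have := add_mem (le_flag _ (n := n + 1) (Nat.lt_succ_self n) hxy)
        (flag_mono _ (Nat.le_succ n) hy)
      simpa using this
  have le2 (i : Fin (d + 1)) : eigenspaces M c i ≤ flag Y (i + 1) := fun x hx =>
    h.mem_flag_of_eigenvector hY (Module.End.mem_eigenspace_iff.1 hx) fun k hk e => by
      rw [hc e] at hk; omega
  funext n
  rcases le_total n (d + 1) with hn | hn
  · exact le_antisymm (flag_le fun j hj => (le2 j).trans (flag_mono _ hj)) (le1 n hn)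
  · rw [hY.flag_eq_top hn, eq_top_iff, ← hY.flag_eq_top le_rfl]
    exact (le1 _ le_rfl).trans (flag_mono _ hn)

theorem FlagScalar.isDecomposition {M : Module.End F V} {Y : Fin (d + 1) → Submodule F V}
    {c : Fin (d + 1) → F} (h : FlagScalar M Y c) (hY : IsDecomposition Y)
    (hc : Function.Injective c) : IsDecomposition (eigenspaces M c) := by
  have e := h.flag_eigenspaces hY hc
  refine isDecomposition_iff.2 ⟨fun i hi => ?_, iSupIndep_eigenspaces M hc, ?_⟩
  · apply hY.flag_succ_ne i
    rw [← e, flag_succ, hi, sup_bot_eq]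
  · rw [← flag_eq_iSup _ le_rfl, e, hY.flag_eq_top le_rfl]

/-- `q ^ (d - 2 i)` -/
def arrowScalar (d : ℕ) (q : F) (i : Fin (d + 1)) : F := q ^ ((d : ℤ) - 2 * (i : ℤ))

theorem arrowScalar_rev {q : F} (i : Fin (d + 1)) :
    arrowScalar d q i.rev = (arrowScalar d q i)⁻¹ := by
  rw [arrowScalar, arrowScalar, ← zpow_neg, Fin.val_rev]
  congr 1
  have := i.2
  omega

theorem arrowScalar_ne_zero {q : F} (hq : q ≠ 0) (i : Fin (d + 1)) : arrowScalar d q i ≠ 0 :=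
  zpow_ne_zero _ hq

theorem IsGeneric.zpow_eq_one {q : F} (hq : IsGeneric q) {n : ℤ} (h : q ^ n = 1) : n = 0 := by
  rcases lt_trichotomy n 0 with hn | hn | hn
  · exfalso
    obtain ⟨m, rfl⟩ := Int.exists_eq_neg_ofNat hn.le
    rw [zpow_neg, inv_eq_one, zpow_natCast] at h
    exact hq.2 m (by omega) h
  · exact hn
  · exfalso
    lift n to ℕ using hn.le
    rw [zpow_natCast] at h
    exact hq.2 n (by omega) h

theorem IsGeneric.zpow_injective {q : F} (hq : IsGeneric q) :
    Function.Injective fun n : ℤ => q ^ n := by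
  intro m n h
  have : q ^ (m - n) = 1 := by
    rw [zpow_sub₀ hq.1, div_eq_one_iff_eq (zpow_ne_zero _ hq.1)]; exact h
  have := hq.zpow_eq_one this
  omega

theorem arrowScalar_injective {q : F} (hq : IsGeneric q) :
    Function.Injective (arrowScalar d q) := by
  intro i j h
  have := hq.zpow_injective h
  apply Fin.ext
  omega

theorem inversion_mapEigenspaces (q : F) (M : Module.End F V) :
    inversion (mapEigenspaces d q M) = eigenspaces M fun i => (arrowScalar d q i)⁻¹ := by
  funext i
  simp only [inversion, mapEigenspaces, eigenspaces, ← arrowScalar_rev]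
  rfl

/-- The working form of an arrow: two conditions linear in `M` instead of equalities of flags. The
`λ_i` are distinct because `q` is not a root of unity. -/
theorem isArrow_iff {q : F} (hq : IsGeneric q) {M : Module.End F V}
    {X Y : Fin (d + 1) → Submodule F V} (hX : IsDecomposition X) (hY : IsDecomposition Y) :
    IsArrow q M X Y ↔ FlagScalar M X (arrowScalar d q) ∧
      FlagScalar M Y fun i => (arrowScalar d q i)⁻¹ := by
  constructor
  · rintro ⟨-, h2, h3⟩
    rw [inversion_mapEigenspaces] at h3
    exact ⟨(flagScalar_eigenspaces M _).congr (partialSums_eq_iff.1 h2),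
      (flagScalar_eigenspaces M _).congr (partialSums_eq_iff.1 h3)⟩
  · rintro ⟨h1, h2⟩
    have hinj := arrowScalar_injective (d := d) hq
    refine ⟨h1.isDecomposition hX hinj, partialSums_eq_iff.2 (h1.flag_eigenspaces hX hinj), ?_⟩
    rw [inversion_mapEigenspaces]
    exact partialSums_eq_iff.2 (h2.flag_eigenspaces hY (inv_injective.comp hinj))

theorem IsArrow.disjoint_flag {q : F} {M : Module.End F V} {X Y : Fin (d + 1) → Submodule F V}
    (h : IsArrow q M X Y) (n : ℕ) : Disjoint (flag X n) (flag Y (d + 1 - n)) := by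
  rw [← partialSums_eq_iff.1 h.2.1, ← partialSums_eq_iff.1 h.2.2]
  exact h.1.disjoint_flag n

end Flags

/-! ### Irreducibility makes flags opposite, and opposite flags give arrows. -/

section Opposite

variable {F V : Type*} [Field F] [AddCommGroup V] [Module F V] {d : ℕ}

/-- Every subspace invariant under `A` and `S` is trivial. -/
def IsIrredPair (A S : Module.End F V) : Prop :=
  ∀ U : Submodule F V, (∀ x ∈ U, A x ∈ U) → (∀ x ∈ U, S x ∈ U) → U = ⊥ ∨ U = ⊤

theorem IsIrredPair.symm {A S : Module.End F V} (h : IsIrredPair A S) : IsIrredPair S A :=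
  fun U h1 h2 => h U h2 h1

theorem mem_iSup_of_map_mem {ι : Type*} {U : ι → Submodule F V} {M : Module.End F V}
    (h : ∀ i, ∀ x ∈ U i, M x ∈ ⨆ j, U j) : ∀ x ∈ ⨆ j, U j, M x ∈ ⨆ j, U j := by
  have : ⨆ j, U j ≤ (⨆ j, U j).comap M := iSup_le h
  exact this

/-- Up to scalars, `A` moves both filtrations one index up and `S` moves both one index down. Sums
of diagonal intersections are therefore invariant under both, and irreducibility decides them. -/
theorem isCompl_of_irred {A S : Module.End F V} (hirr : IsIrredPair A S) {P Q : ℕ → Submodule F V}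
    (hP : Monotone P) (hQ : Antitone Q) (hP0 : P 0 = ⊥) (hQ0 : Q 0 = ⊤) (hP1 : P 1 ≠ ⊥)
    (hQ1 : Q 1 ≠ ⊤) (hSP : ∀ i, ∃ c : F, ∀ x ∈ P (i + 1), S x - c • x ∈ P i)
    (hAP : ∀ i, ∀ x ∈ P i, A x ∈ P (i + 1)) (hAQ : ∀ i, ∃ c : F, ∀ x ∈ Q i, A x - c • x ∈ Q (i + 1))
    (hSQ : ∀ i, ∀ x ∈ Q (i + 1), S x ∈ Q i) (i : ℕ) : IsCompl (P i) (Q i) := by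
  -- As `P 0 = ⊥`, this sum lies inside the proper subspace `Q 1`.
  have hbot : ⨆ i, P i ⊓ Q i = ⊥ := by
    refine (hirr (⨆ i, P i ⊓ Q i) (mem_iSup_of_map_mem fun i x hx => ?_)
      (mem_iSup_of_map_mem fun i x hx => ?_)).resolve_right fun h => hQ1 ?_
    · obtain ⟨c, hc⟩ := hAQ i
      have h1 : A x - c • x ∈ P (i + 1) ⊓ Q (i + 1) :=
        ⟨sub_mem (hAP i x hx.1) (Submodule.smul_mem _ _ (hP (Nat.le_succ i) hx.1)), hc x hx.2⟩
      have := add_mem (le_iSup (fun i => P i ⊓ Q i) (i + 1) h1)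
        (Submodule.smul_mem _ c (le_iSup (fun i => P i ⊓ Q i) i hx))
      simpa using this
    · rcases i with _ | i
      · have : x = 0 := by have := (Submodule.mem_inf.1 hx).1; rwa [hP0, Submodule.mem_bot] at this
        rw [this, map_zero]; exact zero_mem _
      · obtain ⟨c, hc⟩ := hSP i
        have h1 : S x - c • x ∈ P i ⊓ Q i :=
          ⟨hc x hx.1, sub_mem (hSQ i x hx.2) (Submodule.smul_mem _ _ (hQ (Nat.le_succ i) hx.2))⟩
        have := add_mem (le_iSup (fun i => P i ⊓ Q i) i h1)
          (Submodule.smul_mem _ c (le_iSup (fun i => P i ⊓ Q i) (i + 1) hx))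
        simpa using this
    · rw [eq_top_iff, ← h]
      refine iSup_le fun i => ?_
      rcases i with _ | i
      · rw [hP0, bot_inf_eq]; exact bot_le
      · exact inf_le_right.trans (hQ (by omega))
  -- With the index shifted by one, the sum contains `P 1 ⊓ Q 0 = P 1 ≠ ⊥`.
  have htop : ⨆ i, P (i + 1) ⊓ Q i = ⊤ := by
    refine (hirr (⨆ i, P (i + 1) ⊓ Q i) (mem_iSup_of_map_mem fun i x hx => ?_)
      (mem_iSup_of_map_mem fun i x hx => ?_)).resolve_left fun h => hP1 ?_
    · obtain ⟨c, hc⟩ := hAQ i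
      have h1 : A x - c • x ∈ P (i + 1 + 1) ⊓ Q (i + 1) :=
        ⟨sub_mem (hAP _ x hx.1) (Submodule.smul_mem _ _ (hP (Nat.le_succ _) hx.1)), hc x hx.2⟩
      have := add_mem (le_iSup (fun i => P (i + 1) ⊓ Q i) (i + 1) h1)
        (Submodule.smul_mem _ c (le_iSup (fun i => P (i + 1) ⊓ Q i) i hx))
      simpa using this
    · obtain ⟨c, hc⟩ := hSP i
      have h0 := le_iSup (fun i => P (i + 1) ⊓ Q i) i hx
      have h1 : S x - c • x ∈ ⨆ i, P (i + 1) ⊓ Q i := by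
        rcases i with _ | i
        · have := hc x hx.1
          rw [hP0, Submodule.mem_bot] at this
          rw [this]; exact zero_mem _
        · exact le_iSup (fun i => P (i + 1) ⊓ Q i) i
            ⟨hc x hx.1, sub_mem (hSQ i x hx.2) (Submodule.smul_mem _ _ (hQ (Nat.le_succ i) hx.2))⟩
      simpa using add_mem h1 (Submodule.smul_mem _ c h0)
    · rw [eq_bot_iff, ← h]
      refine le_iSup_of_le 0 (le_inf le_rfl ?_)
      rw [hQ0]; exact le_top
  constructor
  · rw [disjoint_iff, eq_bot_iff, ← hbot]
    exact le_iSup (fun i => P i ⊓ Q i) i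
  · rw [codisjoint_iff, eq_top_iff, ← htop]
    refine iSup_le fun k => ?_
    -- Each summand lies in `P i` or in `Q i`, according to the position of `k`.
    rcases lt_or_ge k i with h | h
    · exact (inf_le_left.trans (hP h)).trans le_sup_left
    · exact (inf_le_right.trans (hQ h)).trans le_sup_right

/-- Opposite flags give projections π_n onto the n-th step of one along the complementary step of
the other; the arrow is the combination Σ λ_k (π_{k+1} - π_k). -/
theorem exists_isArrow {q : F} (hq : IsGeneric q) {X Y : Fin (d + 1) → Submodule F V}
    (hX : IsDecomposition X) (hY : IsDecomposition Y)
    (h : ∀ n, IsCompl (flag X n) (flag Y (d + 1 - n))) : ∃ M, IsArrow q M X Y := by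
  let π (n : ℕ) : Module.End F V := (flag X n).projection _ (h n)
  have hπ1 (n : ℕ) (x : V) : π n x ∈ flag X n := Submodule.projection_apply_mem (h n) x
  have hπ2 (n : ℕ) (x : V) (hx : x ∈ flag X n) : π n x = x :=
    Submodule.projection_apply_left (h n) ⟨x, hx⟩
  have hπ3 (n : ℕ) (x : V) (hx : x ∈ flag Y (d + 1 - n)) : π n x = 0 :=
    (Submodule.projection_apply_eq_zero_iff (h n)).2 hx
  have hπ4 (n : ℕ) (x : V) : x - π n x ∈ flag Y (d + 1 - n) :=
    Submodule.sub_projection_mem (h n) x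
  let M : Module.End F V := ∑ k : Fin (d + 1), arrowScalar d q k • (π (k + 1) - π k)
  have hM (x : V) : M x = ∑ k : Fin (d + 1), arrowScalar d q k • (π (k + 1) x - π k x) := by
    simp [M]
  refine ⟨M, (isArrow_iff hq hX hY).2 ⟨fun i x hx => ?_, fun i x hx => ?_⟩⟩
  · rw [hM, ← Finset.add_sum_erase _ _ (Finset.mem_univ i), hπ2 _ _ hx, smul_sub]
    have : ∑ k ∈ Finset.univ.erase i, arrowScalar d q k • (π (k + 1) x - π k x) ∈ flag X i := by
      refine Submodule.sum_mem _ fun k hk => Submodule.smul_mem _ _ ?_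
      rcases lt_or_gt_of_ne (Finset.ne_of_mem_erase hk) with hk | hk
      · exact sub_mem (flag_mono X hk (hπ1 _ x)) (flag_mono X (le_of_lt hk) (hπ1 _ x))
      · rw [hπ2 _ _ (flag_mono X (by omega) hx), hπ2 _ _ (flag_mono X (by omega) hx), sub_self]
        exact zero_mem _
    have := sub_mem this (Submodule.smul_mem _ (arrowScalar d q i) (hπ1 i x))
    convert this using 1
    abel
  · simp only [← arrowScalar_rev]
    rw [hM, ← Finset.add_sum_erase _ _ (Finset.mem_univ i.rev),
      hπ3 i.rev x (by convert hx using 2; rw [Fin.val_rev]; omega), sub_zero]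
    have : ∑ k ∈ Finset.univ.erase i.rev, arrowScalar d q k • (π (k + 1) x - π k x) ∈
        flag Y i := by
      refine Submodule.sum_mem _ fun k hk => Submodule.smul_mem _ _ ?_
      rcases lt_or_gt_of_ne (Finset.ne_of_mem_erase hk) with hk | hk
      · rw [Fin.lt_def, Fin.val_rev] at hk
        rw [hπ3 _ _ (flag_mono Y (by omega) hx), hπ3 _ _ (flag_mono Y (by omega) hx), sub_self]
        exact zero_mem _
      · rw [Fin.lt_def, Fin.val_rev] at hk
        have := sub_mem (flag_mono Y (show d + 1 - k ≤ i by omega) (hπ4 k x))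
          (flag_mono Y (show d + 1 - (k + 1) ≤ i by omega) (hπ4 (k + 1) x))
        convert this using 1
        abel
    have := sub_mem this (Submodule.smul_mem _ (arrowScalar d q i.rev)
      (flag_mono Y (show d + 1 - (i.rev + 1) ≤ i by rw [Fin.val_rev]; omega) (hπ4 (i.rev + 1) x)))
    convert this using 1
    rw [smul_sub]; abel

/-- `M` sends the `i`-th component of `X` into the sum of those with index `i - 1`, `i`, `i + 1`. -/
def IsTridiagonal (M : Module.End F V) (X : Fin (d + 1) → Submodule F V) : Prop :=
  ∀ i : Fin (d + 1), (X i).map M ≤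
    ⨆ j : Fin (d + 1), ⨆ _ : (j : ℕ) ≤ (i : ℕ) + 1 ∧ (i : ℕ) ≤ (j : ℕ) + 1, X j

theorem IsTridiagonal.inversion {M : Module.End F V} {X : Fin (d + 1) → Submodule F V}
    (h : IsTridiagonal M X) : IsTridiagonal M (inversion X) := by
  intro i
  refine (h i.rev).trans (iSup₂_le fun j hj => ?_)
  refine le_iSup₂_of_le j.rev ?_ ?_
  · rw [Fin.val_rev] at hj ⊢; omega
  · rw [QOnsager.inversion, Fin.rev_rev]

theorem IsTridiagonal.mem_flag {M : Module.End F V} {X : Fin (d + 1) → Submodule F V}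
    (h : IsTridiagonal M X) (n : ℕ) : ∀ x ∈ flag X n, M x ∈ flag X (n + 1) := by
  have : flag X n ≤ (flag X (n + 1)).comap M := by
    refine flag_le fun j hj => Submodule.map_le_iff_le_comap.1 ((h j).trans ?_)
    exact iSup₂_le fun k hk => le_flag X (by omega)
  exact this

/-- The two lengths `d` and `e` are kept independent, since their equality is itself deduced from
this statement. -/
theorem isCompl_flag {e : ℕ} {A S : Module.End F V} (hirr : IsIrredPair A S)
    {X : Fin (d + 1) → Submodule F V} {Y : Fin (e + 1) → Submodule F V} (hX : IsDecomposition X)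
    (hY : IsDecomposition Y) {c : Fin (d + 1) → F} {c' : Fin (e + 1) → F} (hSX : FlagScalar S X c)
    (hAY : FlagScalar A Y c') (hAX : IsTridiagonal A X) (hSY : IsTridiagonal S Y) (n : ℕ) :
    IsCompl (flag X n) (flag Y (e + 1 - n)) := by
  refine isCompl_of_irred hirr (P := flag X) (Q := fun n => flag Y (e + 1 - n)) (flag_mono X)
    (fun m n h => flag_mono Y (by omega)) (flag_zero X) (hY.flag_eq_top (by omega)) ?_ ?_
    (fun i => ?_) hAX.mem_flag (fun i => ?_) (fun i x hx => ?_) n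
  · have := hX.flag_succ_ne 0
    rwa [Fin.val_zero, flag_zero, zero_add] at this
  · have := hY.flag_succ_ne (Fin.last e)
    rw [Fin.val_last, hY.flag_eq_top le_rfl] at this
    exact this.symm
  · by_cases hi : i < d + 1
    · exact ⟨c ⟨i, hi⟩, hSX ⟨i, hi⟩⟩
    -- Past the end the filtration is constant, so any scalar will do.
    · refine ⟨0, fun x _ => ?_⟩
      rw [hX.flag_eq_top (by omega)]; trivial
  · by_cases hi : i < e + 1
    · refine ⟨c' ⟨e - i, by omega⟩, fun x hx => ?_⟩
      have := hAY ⟨e - i, by omega⟩ x (by convert hx using 2; simp only; omega)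
      convert this using 2
      simp only; omega
    · refine ⟨0, fun x hx => ?_⟩
      rw [show e + 1 - i = 0 by omega, flag_zero, Submodule.mem_bot] at hx
      rw [hx]; simp
  · by_cases hi : i < e + 1
    · have := hSY.mem_flag _ x hx
      convert this using 2
      omega
    · rw [show e + 1 - (i + 1) = 0 by omega, flag_zero, Submodule.mem_bot] at hx
      rw [hx, map_zero]; exact zero_mem _

/-- If `e > d`, the whole space would be a complement of a step containing `Y 0 ≠ ⊥`. -/
theorem le_of_isTridiagonal {e : ℕ} {A S : Module.End F V} (hirr : IsIrredPair A S)
    {X : Fin (d + 1) → Submodule F V} {Y : Fin (e + 1) → Submodule F V} (hX : IsDecomposition X)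
    (hY : IsDecomposition Y) {c : Fin (d + 1) → F} {c' : Fin (e + 1) → F} (hSX : FlagScalar S X c)
    (hAY : FlagScalar A Y c') (hAX : IsTridiagonal A X) (hSY : IsTridiagonal S Y) : e ≤ d := by
  by_contra! h
  have := (isCompl_flag hirr hX hY hSX hAY hAX hSY (d + 1)).disjoint
  rw [hX.flag_eq_top le_rfl, top_disjoint] at this
  have h1 : Y 0 ≤ ⊥ := by rw [← this]; exact le_flag Y (by simp; omega)
  exact hY.1 0 (le_bot_iff.1 h1)

end Opposite

/-! ### Arrows, q-Weyl relations and the twisted generator. -/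

section Arrows

variable {F V : Type*} [Field F] [AddCommGroup V] [Module F V] {d : ℕ}

theorem mapEigenspaces_inv (q : F) (M : Module.End F V) :
    mapEigenspaces d q⁻¹ M = inversion (mapEigenspaces d q M) := by
  rw [inversion_mapEigenspaces]
  funext i
  simp only [mapEigenspaces, eigenspaces, arrowScalar, inv_zpow]

theorem IsArrow.symm {q : F} {M : Module.End F V} {X Y : Fin (d + 1) → Submodule F V}
    (h : IsArrow q M X Y) : IsArrow q⁻¹ M Y X := by
  rw [IsArrow, mapEigenspaces_inv, inversion_inversion]
  exact ⟨h.1.inversion, h.2.2, h.2.1⟩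

theorem arrowScalar_eq_mul {q : F} (hq : q ≠ 0) {i k : Fin (d + 1)} (h : (i : ℕ) = k + 1) :
    arrowScalar d q k = q ^ 2 * arrowScalar d q i := by
  rw [arrowScalar, arrowScalar, h, ← zpow_natCast, ← zpow_add₀ hq]
  congr 1
  push_cast
  ring

theorem ext_of_isDecomposition {W : Fin (d + 1) → Submodule F V}
    (hW : IsDecomposition W) {f g : Module.End F V} (h : ∀ i, ∀ x ∈ W i, f x = g x) : f = g := by
  have : (⊤ : Submodule F V) ≤ LinearMap.eqLocus f g := by
    rw [← (isDecomposition_iff.1 hW).2.2]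
    exact iSup_le h
  ext x
  exact this trivial

/-- A map stabilizing the flag of `X` with scalars `b λ + b⁻¹ λ⁻¹` and raising that of `Y` satisfies
a `q`-Weyl type relation with the arrow from `X` to `Y`. -/
theorem IsArrow.qWeyl {q : F} (hq : IsGeneric q) {M S : Module.End F V}
    {X Y : Fin (d + 1) → Submodule F V} (hX : IsDecomposition X) (hY : IsDecomposition Y)
    (h : IsArrow q M X Y) {b : F} {c : Fin (d + 1) → F}
    (hc : ∀ i, c i = b * arrowScalar d q i + b⁻¹ * (arrowScalar d q i)⁻¹)
    (hS : FlagScalar S X c) (hSY : ∀ n, ∀ x ∈ flag Y n, S x ∈ flag Y (n + 1)) :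
    q • (S * M) - q⁻¹ • (M * S) = (q - q⁻¹) • (b • (M * M) + b⁻¹ • (1 : Module.End F V)) := by
  obtain ⟨h1, h2⟩ := (isArrow_iff hq hX hY).1 h
  refine ext_of_isDecomposition h.1 fun i w hw => ?_
  have hMw : M w = arrowScalar d q i • w := Module.End.mem_eigenspace_iff.1 hw
  have hwX : w ∈ flag X (i + 1) := by
    rw [← partialSums_eq_iff.1 h.2.1]; exact le_flag _ (Nat.lt_succ_self _) hw
  have hwY : w ∈ flag Y (i.rev + 1) := by
    rw [← partialSums_eq_iff.1 h.2.2]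
    refine le_flag (inversion _) (Nat.lt_succ_self (i.rev : ℕ)) ?_
    rwa [inversion, Fin.rev_rev]
  -- The relation is checked on an eigenvector `w` of `M`. The error `w'` lies low in the flag of
  -- `X` and only one step higher in that of `Y`, which places it in the eigenspace of index `i -
  -- 1`, or makes it zero if `i = 0`.
  set w' := S w - c i • w with hw'
  have hSw : S w = w' + c i • w := by rw [hw', sub_add_cancel]
  have hw'X : w' ∈ flag X i := hS i w hwX
  have hw'Y : w' ∈ flag Y (i.rev + 1 + 1) :=
    sub_mem (hSY _ w hwY) (Submodule.smul_mem _ _ (flag_mono Y (Nat.le_succ _) hwY))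
  have hMw' : M w' = (q ^ 2 * arrowScalar d q i) • w' := by
    rcases hi : (i : ℕ) with _ | k
    · rw [hi, flag_zero, Submodule.mem_bot] at hw'X
      rw [hw'X, map_zero, smul_zero]
    · have hk : k < d + 1 := by omega
      rw [← arrowScalar_eq_mul hq.1 (k := ⟨k, hk⟩) hi, ← sub_eq_zero]
      have e1 := h1 ⟨k, hk⟩ w' (by rwa [hi] at hw'X)
      have e2 := h2 (Fin.rev ⟨k, hk⟩) w' (by
        convert hw'Y using 2; simp only [Fin.val_rev]; omega)
      simp only [arrowScalar_rev, inv_inv] at e2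
      -- `M w' - λ_k w'` lies in steps of the two flags that meet only in zero.
      refine Submodule.disjoint_def.1 (h.disjoint_flag (k + 1)) _
        (flag_mono X (Nat.le_succ _) e1) ?_
      convert e2 using 2
      simp only [Fin.val_rev]
  have hl := arrowScalar_ne_zero hq.1 i
  simp only [LinearMap.sub_apply, LinearMap.smul_apply, Module.End.mul_apply, LinearMap.add_apply,
    Module.End.one_apply, hMw, map_smul, hSw, map_add, hMw', hc]
  have hq0 := hq.1
  match_scalars
  · field_simp; ring
  · field_simp; ring

/-- For an eigenvector `u` of `N` the relation says that `L u - c i • u` is killed by `N - (q²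
λ_i)⁻¹`, and that value occurs among the `λ_k⁻¹` only at `k = i - 1`. -/
theorem FlagScalar.of_qWeyl {q : F} (hq : IsGeneric q) {N L : Module.End F V}
    (hU : IsDecomposition (mapEigenspaces d q N)) {b : F} {c : Fin (d + 1) → F}
    (hc : ∀ i, c i = b * arrowScalar d q i + b⁻¹ * (arrowScalar d q i)⁻¹)
    (h : q • (N * L) - q⁻¹ • (L * N) = (q - q⁻¹) • (b • (1 : Module.End F V) + b⁻¹ • (N * N))) :
    FlagScalar L (inversion (mapEigenspaces d q N)) c := by
  refine flagScalar_of_mem fun i u hu => ?_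
  have hN : FlagScalar N (inversion (mapEigenspaces d q N)) fun i => (arrowScalar d q i)⁻¹ := by
    rw [inversion_mapEigenspaces]; exact flagScalar_eigenspaces _ _
  have hu' : N u = (arrowScalar d q i)⁻¹ • u := by
    rw [inversion_mapEigenspaces] at hu; exact Module.End.mem_eigenspace_iff.1 hu
  have hl := arrowScalar_ne_zero hq.1 i
  have hq0 := hq.1
  -- Excluding all indices `k ≥ i` treats `i = 0` uniformly: the difference then lies in the zero
  -- step of the flag.
  refine hN.mem_flag_of_eigenvector hU.inversion
    (μ := (q ^ 2 * arrowScalar d q i)⁻¹) ?_ fun k hk e => ?_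
  · have e := LinearMap.congr_fun h u
    simp only [LinearMap.sub_apply, LinearMap.smul_apply, Module.End.mul_apply,
      LinearMap.add_apply, Module.End.one_apply, hu', map_smul] at e
    have e' : N (L u) = q⁻¹ • (q • N (L u) - q⁻¹ • (arrowScalar d q i)⁻¹ • L u) +
        (q ^ 2 * arrowScalar d q i)⁻¹ • L u := by
      match_scalars <;> field_simp <;> ring
    rw [map_sub, map_smul, hu', e', e, hc]
    match_scalars <;> field_simp <;> ring
  · rw [inv_inj, arrowScalar, arrowScalar, ← zpow_natCast, ← zpow_add₀ hq.1] at e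
    have := hq.zpow_injective e
    push_cast at this
    omega

/-- The data attached to a pair `A`, `S` acting irreducibly, with eigenvalue sequences of
`q`-Racah type. -/
structure IsRacahPair (q : F) (A S : Module.End F V) (θ θs : Fin (d + 1) → F) (a b : F) :
    Prop where
  dolanGrady : DolanGrady q A S
  irred : IsIrredPair A S
  a_ne_zero : a ≠ 0
  b_ne_zero : b ≠ 0
  eigenvalue : ∀ i, θ i = a * arrowScalar d q i + a⁻¹ * (arrowScalar d q i)⁻¹
  eigenvalue_star : ∀ i, θs i = b * arrowScalar d q i + b⁻¹ * (arrowScalar d q i)⁻¹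
  injective : Function.Injective θ
  injective_star : Function.Injective θs
  dec : IsDecomposition (eigenspaces A θ)
  dec_star : IsDecomposition (eigenspaces S θs)
  tri : IsTridiagonal S (eigenspaces A θ)
  tri_star : IsTridiagonal A (eigenspaces S θs)

/-! ### The arrows at the eigenspaces of the twisted generator. -/

namespace IsRacahPair

variable {q : F} {A S : Module.End F V} {θ θs : Fin (d + 1) → F} {a b : F}

/-- Reversing indices inverts every `λ_i`, which exchanges `a` with `a⁻¹`. With `rev_star`, this
reduces the four corner arrows to one. -/
theorem rev (h : IsRacahPair q A S θ θs a b) :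
    IsRacahPair q A S (fun i => θ i.rev) θs a⁻¹ b where
  __ := h
  a_ne_zero := inv_ne_zero h.a_ne_zero
  eigenvalue i := by rw [h.eigenvalue, arrowScalar_rev, inv_inv, inv_inv, add_comm]
  injective := h.injective.comp Fin.rev_injective
  dec := h.dec.inversion
  tri := h.tri.inversion

theorem rev_star (h : IsRacahPair q A S θ θs a b) :
    IsRacahPair q A S θ (fun i => θs i.rev) a b⁻¹ where
  __ := h
  b_ne_zero := inv_ne_zero h.b_ne_zero
  eigenvalue_star i := by rw [h.eigenvalue_star, arrowScalar_rev, inv_inv, inv_inv, add_comm]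
  injective_star := h.injective_star.comp Fin.rev_injective
  dec_star := h.dec_star.inversion
  tri_star := h.tri_star.inversion

theorem exists_isArrow (hq : IsGeneric q) (h : IsRacahPair q A S θ θs a b) :
    ∃ B, IsArrow q B (eigenspaces S θs) (eigenspaces A θ) :=
  QOnsager.exists_isArrow hq h.dec_star h.dec fun n =>
    isCompl_flag h.irred h.dec_star h.dec (flagScalar_eigenspaces S θs)
      (flagScalar_eigenspaces A θ) h.tri_star h.tri n

theorem flagScalar_comb (hq : IsGeneric q) (h : IsRacahPair q A S θ θs a b) {B : Module.End F V}
    (hB : IsArrow q B (eigenspaces S θs) (eigenspaces A θ)) :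
    FlagScalar (a⁻¹ • A - (a ^ 2)⁻¹ • B) (eigenspaces A θ) (arrowScalar d q) := by
  have := (flagScalar_eigenspaces A θ).linear_comb
    ((isArrow_iff hq h.dec_star h.dec).1 hB).2 a⁻¹ (-(a ^ 2)⁻¹)
  rw [neg_smul, ← sub_eq_add_neg] at this
  convert this using 1
  funext i
  have := h.a_ne_zero
  have hl := arrowScalar_ne_zero hq.1 i
  rw [h.eigenvalue]
  field_simp
  ring

/-- The twisted operator is not assumed diagonalizable: the q-Weyl relation makes it triangular with
the distinct diagonal `θs`, so its eigenspaces form a decomposition whose flag is the reversed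
eigenspace flag of `N`. -/
theorem twist_arrow (hq : IsGeneric q) (h : IsRacahPair q A S θ θs a b) {B : Module.End F V}
    (hB : IsArrow q B (eigenspaces S θs) (eigenspaces A θ)) :
    IsDecomposition (eigenspaces (twistElt q⁻¹ A S) θs) ∧
      IsArrow q (a⁻¹ • A - (a ^ 2)⁻¹ • B) (eigenspaces A θ)
        (eigenspaces (twistElt q⁻¹ A S) θs) := by
  have h1 := h.flagScalar_comb hq hB
  set N := a⁻¹ • A - (a ^ 2)⁻¹ • B with hN
  have r1 : q • (B * A) - q⁻¹ • (A * B) =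
      (q - q⁻¹) • (a⁻¹ • (B * B) + a • (1 : Module.End F V)) := by
    -- The arrow is read backwards, with `q⁻¹` for `q`; its scalars are then `λ_i⁻¹`, so the role of
    -- `b` is played by `a⁻¹`.
    have := hB.symm.qWeyl hq.inv h.dec h.dec_star (b := a⁻¹) (c := θ) (S := A)
      (fun i => by
        rw [h.eigenvalue]
        simp only [arrowScalar, inv_zpow, inv_inv]
        ring) (flagScalar_eigenspaces A θ) h.tri_star.mem_flag
    rw [inv_inv, inv_inv] at this
    rw [← neg_sub, this, ← neg_smul, neg_sub]
  have r2 := hB.qWeyl hq h.dec_star h.dec h.eigenvalue_star (flagScalar_eigenspaces S θs)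
    h.tri.mem_flag
  have key := qWeyl_twist hq h.a_ne_zero h.b_ne_zero r1 r2 h.dolanGrady hN
  have hU : IsDecomposition (mapEigenspaces d q N) :=
    h1.isDecomposition h.dec (arrowScalar_injective hq)
  have hL := FlagScalar.of_qWeyl hq hU h.eigenvalue_star key
  have hd := hL.isDecomposition hU.inversion h.injective_star
  refine ⟨hd, (isArrow_iff hq h.dec hd).2 ⟨h1, ?_⟩⟩
  refine FlagScalar.congr ?_ (hL.flag_eigenspaces hU.inversion h.injective_star).symm
  rw [inversion_mapEigenspaces]
  exact flagScalar_eigenspaces _ _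

theorem twist_arrow_rev (hq : IsGeneric q) (h : IsRacahPair q A S θ θs a b) {K : Module.End F V}
    (hK : IsArrow q K (eigenspaces S θs) (inversion (eigenspaces A θ))) :
    IsArrow q (a • A - a ^ 2 • K) (inversion (eigenspaces A θ))
        (eigenspaces (twistElt q⁻¹ A S) θs) := by
  have := (h.rev.twist_arrow hq (B := K) hK).2
  rw [inv_inv, inv_pow, inv_inv] at this
  exact this

/-- On the flag of `A*` both `K` and `B` act by `λ_i`. At the other end use `a K - a⁻¹ B = a N - a⁻¹
N'` with `N = a⁻¹A - a⁻²B` and `N' = aA - a²K`, both acting by `λ_i⁻¹`. -/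
theorem vertical_arrow (hq : IsGeneric q) (h : IsRacahPair q A S θ θs a b) (ha : a - a⁻¹ ≠ 0)
    {K B : Module.End F V} (hK : IsArrow q K (eigenspaces S θs) (inversion (eigenspaces A θ)))
    (hB : IsArrow q B (eigenspaces S θs) (eigenspaces A θ)) :
    IsArrow q ((a - a⁻¹)⁻¹ • (a • K - a⁻¹ • B)) (eigenspaces S θs)
        (eigenspaces (twistElt q⁻¹ A S) θs) := by
  obtain ⟨hd, hB'⟩ := h.twist_arrow hq hB
  have hK' := h.twist_arrow_rev hq hK
  have ha0 := h.a_ne_zero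
  have ha1 : a ^ 2 - 1 ≠ 0 := fun e => ha (by field_simp; linear_combination e)
  refine (isArrow_iff hq h.dec_star hd).2 ⟨?_, ?_⟩
  · have := ((isArrow_iff hq h.dec_star h.dec.inversion).1 hK).1.linear_comb
      ((isArrow_iff hq h.dec_star h.dec).1 hB).1 ((a - a⁻¹)⁻¹ * a) (-((a - a⁻¹)⁻¹ * a⁻¹))
    convert this using 1
    · module
    · funext i; field_simp; ring
  · have := ((isArrow_iff hq h.dec hd).1 hB').2.linear_comb
      ((isArrow_iff hq h.dec.inversion hd).1 hK').2 ((a - a⁻¹)⁻¹ * a) (-((a - a⁻¹)⁻¹ * a⁻¹))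
    convert this using 1
    · match_scalars <;> field_simp <;> ring
    · funext i; field_simp; ring

end IsRacahPair

end Arrows

/-! ### Adjacent scalars and q-Racah sequences. -/

section Standard

variable {F V : Type*} [Field F] [AddCommGroup V] [Module F V] {d : ℕ}

theorem adjPoly_comm (q x y : F) : adjPoly q x y = adjPoly q y x := by
  simp only [adjPoly]; ring

/-- Vieta for the quadratic in the second variable; along a path it becomes the three-term
recurrence. -/
theorem adjPoly_add_eq {q x r s : F} (hr : adjPoly q x r = 0) (hs : adjPoly q x s = 0)
    (hrs : r ≠ s) : r + s = (q ^ 2 + q⁻¹ ^ 2) * x := by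
  apply mul_left_cancel₀ (sub_ne_zero.2 hrs)
  simp only [adjPoly] at hr hs
  linear_combination hr - hs

theorem adjPoly_roots {q x r s t : F} (hr : adjPoly q x r = 0) (hs : adjPoly q x s = 0)
    (hrs : r ≠ s) (ht : adjPoly q x t = 0) : t = r ∨ t = s := by
  by_cases h : t = r
  · exact Or.inl h
  · right
    linear_combination adjPoly_add_eq ht hr h - adjPoly_add_eq hr hs hrs

/-- The sequence `a q ^ (d - 2 n) + a⁻¹ q ^ (2 n - d)`. -/
def racahSeq (q a : F) (d : ℕ) (n : ℤ) : F :=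
  a * q ^ ((d : ℤ) - 2 * n) + a⁻¹ * (q ^ ((d : ℤ) - 2 * n))⁻¹

theorem racahSeq_step {q : F} (hq : q ≠ 0) (n : ℤ) :
    q ^ ((d : ℤ) - 2 * (n + 1)) = q ^ ((d : ℤ) - 2 * n) * (q ^ 2)⁻¹ := by
  rw [← zpow_natCast, ← zpow_neg, ← zpow_add₀ hq]
  congr 1
  push_cast
  ring

theorem racahSeq_step' {q : F} (hq : q ≠ 0) (n : ℤ) :
    q ^ ((d : ℤ) - 2 * (n - 1)) = q ^ ((d : ℤ) - 2 * n) * q ^ 2 := by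
  rw [← zpow_natCast, ← zpow_add₀ hq]
  congr 1
  push_cast
  ring

theorem racahSeq_add {q : F} (hq : q ≠ 0) (a : F) (n : ℤ) :
    racahSeq q a d (n + 1) + racahSeq q a d (n - 1) =
      (q ^ 2 + q⁻¹ ^ 2) * racahSeq q a d n := by
  have := zpow_ne_zero ((d : ℤ) - 2 * n) hq
  rw [racahSeq, racahSeq, racahSeq, racahSeq_step hq, racahSeq_step' hq]
  generalize q ^ ((d : ℤ) - 2 * n) = l at *
  rw [mul_inv, mul_inv, inv_inv]
  ring

theorem racahSeq_mul {q a : F} (hq : q ≠ 0) (ha : a ≠ 0) (n : ℤ) :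
    racahSeq q a d (n + 1) * racahSeq q a d (n - 1) =
      racahSeq q a d n ^ 2 + (q ^ 2 - q⁻¹ ^ 2) ^ 2 := by
  have := zpow_ne_zero ((d : ℤ) - 2 * n) hq
  rw [racahSeq, racahSeq, racahSeq, racahSeq_step hq, racahSeq_step' hq]
  generalize q ^ ((d : ℤ) - 2 * n) = l at *
  field_simp
  ring

theorem racahSeq_of_adjPoly {q a : F} (hq : q ≠ 0) (ha : a ≠ 0) {n : ℤ} {y : F}
    (h : adjPoly q (racahSeq q a d n) y = 0) :
    y = racahSeq q a d (n + 1) ∨ y = racahSeq q a d (n - 1) := by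
  have : (y - racahSeq q a d (n + 1)) * (y - racahSeq q a d (n - 1)) = 0 := by
    rw [adjPoly] at h
    linear_combination h - y * racahSeq_add hq a n + racahSeq_mul hq ha n
  simpa [sub_eq_zero] using this

/-- For u, v the powers of q at `m`, `n`, equal values force u = v or a²uv = 1. In the second case
the whole sequence is symmetric under `m + k ↔ n - k`. -/
theorem racahSeq_eq {q a : F} (hq : IsGeneric q) (ha : a ≠ 0) {m n : ℤ}
    (h : racahSeq q a d m = racahSeq q a d n) :
    m = n ∨ ∀ k, racahSeq q a d (m + k) = racahSeq q a d (n - k) := by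
  have hm := zpow_ne_zero ((d : ℤ) - 2 * m) hq.1
  have hn := zpow_ne_zero ((d : ℤ) - 2 * n) hq.1
  have key : (q ^ ((d : ℤ) - 2 * m) - q ^ ((d : ℤ) - 2 * n)) *
      (a ^ 2 * (q ^ ((d : ℤ) - 2 * m) * q ^ ((d : ℤ) - 2 * n)) - 1) = 0 := by
    rw [racahSeq, racahSeq] at h
    generalize q ^ ((d : ℤ) - 2 * m) = u at *
    generalize q ^ ((d : ℤ) - 2 * n) = v at *
    field_simp at h
    linear_combination h
  rcases mul_eq_zero.1 key with h | h
  · left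
    have := hq.zpow_injective (sub_eq_zero.1 h)
    omega
  · right
    intro k
    have e1 : q ^ ((d : ℤ) - 2 * (m + k)) = q ^ ((d : ℤ) - 2 * m) * (q ^ (2 * k))⁻¹ := by
      rw [← zpow_neg, ← zpow_add₀ hq.1]; congr 1; ring
    have e2 : q ^ ((d : ℤ) - 2 * (n - k)) = q ^ ((d : ℤ) - 2 * n) * q ^ (2 * k) := by
      rw [← zpow_add₀ hq.1]; congr 1; ring
    have hk := zpow_ne_zero (2 * k) hq.1
    rw [racahSeq, racahSeq, e1, e2]
    generalize q ^ ((d : ℤ) - 2 * m) = u at *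
    generalize q ^ ((d : ℤ) - 2 * n) = v at *
    generalize q ^ (2 * k) = w at *
    field_simp
    linear_combination (u - w ^ 2 * v) * h

/-- The roots adjacent to `θ i` are the terms `i ± 1` of the sequence extended to all integers. Only
at an end of the index range can such a term lie outside, and then the reflection symmetry controls
the coincidence. -/
theorem index_adjacent {q a : F} (hq : IsGeneric q) (ha : a ≠ 0) {θ : Fin (d + 1) → F}
    (hθ : Function.Injective θ)
    (h : ∀ i, θ i = a * arrowScalar d q i + a⁻¹ * (arrowScalar d q i)⁻¹) {i j : Fin (d + 1)}
    (hij : adjPoly q (θ i) (θ j) = 0) : (j : ℕ) ≤ (i : ℕ) + 1 ∧ (i : ℕ) ≤ (j : ℕ) + 1 := by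
  have h' (i : Fin (d + 1)) : θ i = racahSeq q a d (i : ℤ) := h i
  have inj {m n : ℤ} (hm : 0 ≤ m ∧ m ≤ d) (hn : 0 ≤ n ∧ n ≤ d)
      (e : racahSeq q a d m = racahSeq q a d n) : m = n := by
    obtain ⟨m, rfl⟩ := Int.eq_ofNat_of_zero_le hm.1
    obtain ⟨n, rfl⟩ := Int.eq_ofNat_of_zero_le hn.1
    have := hθ (a₁ := ⟨m, by omega⟩) (a₂ := ⟨n, by omega⟩) (by rw [h', h']; exact e)
    rw [Fin.mk.injEq] at this
    omega
  have hi := i.2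
  have hj := j.2
  rw [h', h'] at hij
  rcases racahSeq_of_adjPoly hq.1 ha hij with e | e
  · by_cases h1 : (i : ℤ) + 1 ≤ d
    · have := inj (by omega) (by omega) e
      omega
    · rcases racahSeq_eq hq ha e with h2 | h2
      · omega
      · by_cases h3 : (j : ℤ) + 1 ≤ d
        · have e3 := h2 1
          rw [add_sub_cancel_right] at e3
          have := inj (by omega) (by omega) e3
          omega
        · omega
  · by_cases h1 : 0 ≤ (i : ℤ) - 1
    · have := inj (by omega) (by omega) e
      omega
    · rcases racahSeq_eq hq ha e with h2 | h2
      · omega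
      · by_cases h3 : 0 ≤ (j : ℤ) - 1
        · have e3 := h2 (-1)
          rw [sub_neg_eq_add, sub_add_cancel] at e3
          have := inj (by omega) (by omega) e3
          omega
        · omega

/-- The recurrence has solutions α q^(-2n) + β q^(2n) determined by two initial values; adjacency of
those values is what makes αβ = 1. -/
theorem exists_racah_parameter {q : F} (hq : IsGeneric q) (hd : 0 < d) {θ : Fin (d + 1) → F}
    (hθ : Function.Injective θ)
    (hadj : ∀ i j : Fin (d + 1), (j : ℕ) = (i : ℕ) + 1 → adjPoly q (θ i) (θ j) = 0) :
    ∃ a : F, a ≠ 0 ∧ ∀ i, θ i = a * arrowScalar d q i + a⁻¹ * (arrowScalar d q i)⁻¹ := by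
  set x := θ 0
  set y := θ ⟨1, by omega⟩
  have hxy : adjPoly q x y = 0 := hadj 0 ⟨1, by omega⟩ (by simp)
  have g := hq.sub_ne_zero two_pos
  have hq0 := hq.1
  have hl := zpow_ne_zero (d : ℤ) hq.1
  set l := q ^ (d : ℤ) with hl_def
  -- `a` and `a'` solve `x = a l + a' l⁻¹`, `y = a l q⁻² + a' l⁻¹ q²`.
  set a := (q ^ 2 * x - y) * (l * (q ^ 2 - q⁻¹ ^ 2))⁻¹ with ha_def
  set a' := (y - q⁻¹ ^ 2 * x) * l * (q ^ 2 - q⁻¹ ^ 2)⁻¹ with ha'_def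
  have haa : a * a' = 1 := by
    have : (q ^ 2 * x - y) * (y - q⁻¹ ^ 2 * x) = (q ^ 2 - q⁻¹ ^ 2) ^ 2 := by
      rw [adjPoly] at hxy
      have : q ^ 2 * q⁻¹ ^ 2 = 1 := by field_simp
      linear_combination -hxy - x ^ 2 * this
    rw [ha_def, ha'_def]
    generalize q ^ 2 - q⁻¹ ^ 2 = G at *
    calc _ = (q ^ 2 * x - y) * (y - q⁻¹ ^ 2 * x) / G ^ 2 * (l * l⁻¹) := by
          rw [mul_inv]; ring
      _ = 1 := by rw [this, div_self (pow_ne_zero 2 g), mul_inv_cancel₀ hl, one_mul]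
  have ha : a ≠ 0 := left_ne_zero_of_mul_eq_one haa
  have ha' : a⁻¹ = a' := inv_eq_of_mul_eq_one_right haa
  refine ⟨a, ha, fun i => ?_⟩
  have gen : ∀ n : ℕ, ∀ hn : n < d + 1, θ ⟨n, hn⟩ = racahSeq q a d (n : ℤ) := by
    intro n
    induction n using Nat.twoStepInduction with
    | zero =>
      intro hn
      rw [racahSeq, ha', Nat.cast_zero, mul_zero, sub_zero, ← hl_def, ha_def, ha'_def]
      change x = _
      generalize hG : q ^ 2 - q⁻¹ ^ 2 = G at *
      field_simp
      rw [← hG]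
      field_simp
      ring
    | one =>
      intro hn
      have e : q ^ ((d : ℤ) - 2 * ((1 : ℕ) : ℤ)) = l * (q ^ 2)⁻¹ := by
        have := racahSeq_step (d := d) hq0 0
        rw [mul_zero, sub_zero] at this
        simpa only [Nat.cast_one, zero_add] using this
      rw [racahSeq, ha', e, ha_def, ha'_def]
      change y = _
      have hG' : q ^ 4 - 1 = q ^ 2 * (q ^ 2 - q⁻¹ ^ 2) := by field_simp
      generalize hG : q ^ 2 - q⁻¹ ^ 2 = G at *
      field_simp
      linear_combination (-y) * hG'
    | more n ih1 ih2 =>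
      intro hn
      have e1 := ih1 (by omega)
      have e2 := ih2 (by omega)
      have h1 := hadj ⟨n, by omega⟩ ⟨n + 1, by omega⟩ rfl
      have h2 := hadj ⟨n + 1, by omega⟩ ⟨n + 2, hn⟩ rfl
      rw [adjPoly_comm] at h1
      have h3 := adjPoly_add_eq h2 h1 (fun e => by
        have := hθ e
        rw [Fin.mk.injEq] at this
        omega)
      rw [e1, e2] at h3
      have h4 := racahSeq_add (d := d) hq0 a ((n + 1 : ℕ) : ℤ)
      have c1 : ((n + 1 : ℕ) : ℤ) + 1 = ((n + 2 : ℕ) : ℤ) := by push_cast; ring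
      have c2 : ((n + 1 : ℕ) : ℤ) - 1 = (n : ℤ) := by push_cast; ring
      rw [c1, c2] at h4
      linear_combination h3 - h4
  exact gen i i.2

/-! ### Consequences of the Dolan/Grady relation for eigenspaces. -/

/-- Applied to an eigenvector, the relation becomes p(A)(S x) = 0 with p(t) = (t - μ) P(μ, t). As
`A` is diagonalizable, ker p(A) is the sum of the eigenspaces for the roots of p. -/
theorem mem_of_dolanGrady [FiniteDimensional F V] {q : F} {A S : Module.End F V} (hdg :
        DolanGrady q A S)
    (hA : IsDiagonalizable A) (hq : q ≠ 0) {μ : F} {x : V} (hx : A x = μ • x) {U : Submodule F V}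
    (hU : ∀ ν, A.HasEigenvalue ν → ν = μ ∨ adjPoly q μ ν = 0 → A.eigenspace ν ≤ U) : S x ∈ U := by
  let p : Module.End F V → Module.End F V := fun A =>
    (A - μ • 1) * (A * A - ((q ^ 2 + q⁻¹ ^ 2) * μ) • A + (μ ^ 2 + (q ^ 2 - q⁻¹ ^ 2) ^ 2) • 1)
  have hcomm : Commute A (p A) := by
    have h1 : Commute A (1 : Module.End F V) := Commute.one_right A
    have h2 : Commute A A := Commute.refl A
    exact (h2.sub_right (h1.smul_right _)).mul_right
      (((h2.mul_right h2).sub_right (h2.smul_right _)).add_right (h1.smul_right _))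
  have hpv (ν : F) (v : V) (hv : A v = ν • v) : p A v = ((ν - μ) * adjPoly q μ ν) • v := by
    simp only [p, adjPoly, Module.End.mul_apply, LinearMap.sub_apply, LinearMap.add_apply,
      LinearMap.smul_apply, Module.End.one_apply, hv, map_smul, map_sub, map_add]
    module
  have h0 : p A (S x) = 0 := by
    have e := LinearMap.congr_fun hdg x
    simp only [Ring.lie_def, qComm, LinearMap.sub_apply, LinearMap.smul_apply,
      Module.End.mul_apply, hx, map_smul, map_sub, inv_inv] at e
    simp only [p, Module.End.mul_apply, LinearMap.sub_apply, LinearMap.add_apply,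
      LinearMap.smul_apply, Module.End.one_apply, map_smul, map_sub, map_add]
    rw [← sub_eq_zero] at e
    rw [← e]
    match_scalars <;> field_simp <;> ring
  have hinv : ∀ x ∈ LinearMap.ker (p A), A x ∈ LinearMap.ker (p A) := fun x hx => by
    rw [LinearMap.mem_ker] at hx ⊢
    have := LinearMap.congr_fun hcomm.eq x
    exact (this.symm.trans (congrArg A hx)).trans (map_zero A)
  have hker := Submodule.inf_iSup_genEigenspace hinv 1
  have htop : ⨆ ν : F, A.genEigenspace ν 1 = ⊤ := hA
  rw [htop, inf_top_eq] at hker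
  have hle : LinearMap.ker (p A) ≤ U := by
    rw [hker]
    refine iSup_le fun ν v hv => ?_
    have hv2 : v ∈ A.eigenspace ν := (Submodule.mem_inf.1 hv).2
    by_cases hv0 : v = 0
    · rw [hv0]; exact zero_mem _
    have hv1 := LinearMap.mem_ker.1 (Submodule.mem_inf.1 hv).1
    rw [hpv ν v (Module.End.mem_eigenspace_iff.1 hv2)] at hv1
    have := (smul_eq_zero.1 hv1).resolve_right hv0
    refine hU ν (Module.End.hasEigenvalue_of_hasEigenvector ⟨hv2, hv0⟩) ?_ hv2
    rcases mul_eq_zero.1 this with h | h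
    · exact Or.inl (sub_eq_zero.1 h)
    · exact Or.inr h
  exact hle (LinearMap.mem_ker.2 h0)

theorem IsEigenvalueOrdering.isDecomposition {A : Module.End F V} (hA : IsDiagonalizable A)
    {θ : Fin (d + 1) → F} (h : IsEigenvalueOrdering A θ) : IsDecomposition (eigenspaces A θ) := by
  refine isDecomposition_iff.2 ⟨fun i => (h.2 _).2 ⟨i, rfl⟩, iSupIndep_eigenspaces A h.1, ?_⟩
  rw [eq_top_iff, ← show ⨆ μ : F, A.eigenspace μ = ⊤ from hA]
  refine iSup_le fun μ => ?_
  by_cases hμ : A.HasEigenvalue μ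
  · obtain ⟨i, rfl⟩ := (h.2 μ).1 hμ
    exact le_iSup (eigenspaces A θ) i
  · rw [Module.End.HasEigenvalue, Module.End.HasUnifEigenvalue, not_not] at hμ
    rw [show A.eigenspace μ = ⊥ from hμ]; exact bot_le

theorem isTridiagonal_of_adjacent [FiniteDimensional F V] {q : F} (hq : IsGeneric q) {A S :
        Module.End F V}
    (hdg : DolanGrady q A S) (hA : IsDiagonalizable A) {θ : Fin (d + 1) → F}
    (h : IsEigenvalueOrdering A θ) {a : F} (ha : a ≠ 0)
    (hθ : ∀ i, θ i = a * arrowScalar d q i + a⁻¹ * (arrowScalar d q i)⁻¹) :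
    IsTridiagonal S (eigenspaces A θ) := by
  intro i
  rw [Submodule.map_le_iff_le_comap]
  intro x hx
  rw [Submodule.mem_comap]
  refine mem_of_dolanGrady hdg hA hq.1 (Module.End.mem_eigenspace_iff.1 hx) fun ν hν hadj => ?_
  obtain ⟨j, rfl⟩ := (h.2 ν).1 hν
  refine le_iSup₂_of_le j ?_ le_rfl
  rcases hadj with e | e
  · rw [h.1 e]; omega
  · exact index_adjacent hq ha h.1 hθ e

/-- If two consecutive eigenvalues were not adjacent, the partial sum of eigenspaces ending between
them would be a proper nonzero invariant subspace. -/
theorem adjacent_of_isTridiagonal [FiniteDimensional F V] {q : F} (hq : q ≠ 0) {A S : Module.End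
        F V}
    (hdg : DolanGrady q S A) (hS : IsDiagonalizable S) (hirr : IsIrredPair A S)
    {θ : Fin (d + 1) → F} (h : IsEigenvalueOrdering S θ) (ht : IsTridiagonal A (eigenspaces S θ))
    (i j : Fin (d + 1)) (hij : (j : ℕ) = (i : ℕ) + 1) : adjPoly q (θ i) (θ j) = 0 := by
  by_contra hne
  have hdec := h.isDecomposition hS
  have hAj : flag (eigenspaces S θ) j ≤ (flag (eigenspaces S θ) j).comap A := by
    refine flag_le fun k hk x hx => ?_
    have hx2 : A x ∈ flag (eigenspaces S θ) (k + 1 + 1) :=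
      ht.mem_flag _ x (le_flag _ (Nat.lt_succ_self _) hx)
    by_cases hki : (k : ℕ) = i
    · obtain rfl := Fin.ext hki
      rw [← hij, flag_succ] at hx2
      obtain ⟨u, hu, v, hv, huv⟩ := Submodule.mem_sup.1 hx2
      -- By Dolan/Grady, `A x` has no component in the `j`-th eigenspace, as `θ j` is neither equal
      -- nor adjacent to the eigenvalue of `x`.
      have h1 : A x ∈ ⨆ m, ⨆ _ : m ≠ j, eigenspaces S θ m := by
        refine mem_of_dolanGrady hdg hS hq (Module.End.mem_eigenspace_iff.1 hx)
          fun ν hν hadj => ?_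
        obtain ⟨m, rfl⟩ := (h.2 ν).1 hν
        refine le_iSup₂_of_le (f := fun m (_ : m ≠ j) => eigenspaces S θ m) m ?_ le_rfl
        rintro rfl
        rcases hadj with e | e
        · have := h.1 e; rw [this] at hij; omega
        · exact hne e
      have h2 : u ∈ ⨆ m, ⨆ _ : m ≠ j, eigenspaces S θ m :=
        flag_le (fun m hm => le_iSup₂_of_le (f := fun m (_ : m ≠ j) => eigenspaces S θ m) m
          (fun e => by rw [e] at hm; omega) le_rfl) hu
      have h3 : v = 0 := by
        refine Submodule.disjoint_def.1 ((isDecomposition_iff.1 hdec).2.1 j) v hv ?_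
        have := sub_mem h1 h2
        rwa [← huv, add_sub_cancel_left] at this
      rw [Submodule.mem_comap, ← huv, h3, add_zero]
      exact hu
    · exact flag_mono _ (by omega) hx2
  have hSj : flag (eigenspaces S θ) j ≤ (flag (eigenspaces S θ) j).comap S := by
    refine flag_le fun k hk x hx => ?_
    rw [Submodule.mem_comap, Module.End.mem_eigenspace_iff.1 hx]
    exact Submodule.smul_mem _ _ (le_flag _ hk hx)
  rcases hirr (flag (eigenspaces S θ) j) hAj hSj with e | e
  · apply hdec.1 0
    rw [← le_bot_iff, ← e]
    exact le_flag _ (by rw [hij]; simp)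
  · apply hdec.flag_succ_ne j
    rw [e, eq_top_iff, ← e]
    exact flag_mono _ (Nat.le_succ _)

/-! ### Existence of the standard orderings. -/

/-- A path of distinct eigenvalues in which consecutive ones are adjacent. -/
def IsEigenvaluePath (q : F) (A : Module.End F V) (θ : Fin (d + 1) → F) : Prop :=
  Function.Injective θ ∧ (∀ i, A.HasEigenvalue (θ i)) ∧
    ∀ i j : Fin (d + 1), (j : ℕ) = (i : ℕ) + 1 → adjPoly q (θ i) (θ j) = 0

theorem IsEigenvaluePath.rev {q : F} {A : Module.End F V} {θ : Fin (d + 1) → F}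
    (h : IsEigenvaluePath q A θ) : IsEigenvaluePath q A fun i => θ i.rev := by
  refine ⟨h.1.comp Fin.rev_injective, fun i => h.2.1 _, fun i j hij => ?_⟩
  rw [adjPoly_comm]
  refine h.2.2 _ _ ?_
  rw [Fin.val_rev, Fin.val_rev]
  omega

theorem IsEigenvaluePath.mem_of_adjacent_zero {q : F} {A : Module.End F V} {θ : Fin (d + 1) → F}
    (h : IsEigenvaluePath q A θ)
    (hmax : ∀ θ' : Fin (d + 1 + 1) → F, ¬ IsEigenvaluePath q A θ') {ν : F}
    (hν : A.HasEigenvalue ν) (hadj : adjPoly q (θ 0) ν = 0) : ∃ j, θ j = ν := by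
  by_contra hne
  push Not at hne
  refine hmax (Fin.cons ν θ) ⟨Fin.cons_injective_iff.2 ⟨?_, h.1⟩, fun i => ?_, fun i j hij => ?_⟩
  · rintro ⟨j, hj⟩; exact hne j hj
  · refine Fin.cases ?_ (fun i => ?_) i
    · exact hν
    · exact h.2.1 i
  · obtain ⟨j, rfl⟩ := Fin.exists_succ_eq.2 (show j ≠ 0 by rintro rfl; simp at hij)
    rcases Fin.eq_zero_or_eq_succ i with rfl | ⟨i, rfl⟩
    · obtain rfl : j = 0 := Fin.ext (by simpa using hij)
      rw [adjPoly_comm]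
      exact hadj
    · exact h.2.2 i j (by simpa using hij)

/-- At an interior point both roots of the quadratic are already taken by the neighbours; at an end
a new root would lengthen the path. -/
theorem IsEigenvaluePath.mem_of_adjacent {q : F} {A : Module.End F V} {θ : Fin (d + 1) → F}
    (h : IsEigenvaluePath q A θ)
    (hmax : ∀ θ' : Fin (d + 1 + 1) → F, ¬ IsEigenvaluePath q A θ') {ν : F}
    (hν : A.HasEigenvalue ν) (i : Fin (d + 1)) (hadj : adjPoly q (θ i) ν = 0) :
    ∃ j, θ j = ν := by
  have hi := i.2
  by_cases h0 : (i : ℕ) = 0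
  · obtain rfl : i = 0 := Fin.ext h0
    exact h.mem_of_adjacent_zero hmax hν hadj
  by_cases hd : (i : ℕ) = d
  · obtain rfl : i = Fin.last d := Fin.ext hd
    obtain ⟨j, hj⟩ := h.rev.mem_of_adjacent_zero hmax hν (by simpa using hadj)
    exact ⟨_, hj⟩
  have h1 := h.2.2 ⟨i - 1, by omega⟩ i (by simp only; omega)
  have h2 := h.2.2 i ⟨i + 1, by omega⟩ rfl
  rw [adjPoly_comm] at h1
  rcases adjPoly_roots h1 h2 (fun e => by
    have := h.1 e
    rw [Fin.mk.injEq] at this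
    omega) hadj with e | e
  · exact ⟨_, e.symm⟩
  · exact ⟨_, e.symm⟩

/-- Path lengths are bounded by the dimension. The eigenspaces along a longest path span an
invariant subspace, hence everything, so no eigenvalue is missed. -/
theorem exists_eigenvalueOrdering [FiniteDimensional F V] [Nontrivial V] {q : F} (hq : q ≠ 0)
    {A S : Module.End F V} (hdg : DolanGrady q A S) (hA : IsDiagonalizable A)
    (hirr : IsIrredPair A S) :
    ∃ (d : ℕ) (θ : Fin (d + 1) → F), IsEigenvalueOrdering A θ ∧
      ∀ i j : Fin (d + 1), (j : ℕ) = (i : ℕ) + 1 → adjPoly q (θ i) (θ j) = 0 := by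
  classical
  let P : ℕ → Prop := fun d => ∃ θ : Fin (d + 1) → F, IsEigenvaluePath q A θ
  have hbound (d : ℕ) (h : P d) : d ≤ Module.finrank F V := by
    obtain ⟨θ, h1, h2, -⟩ := h
    choose v hv using fun i => (h2 i).exists_hasEigenvector
    have := (Module.End.eigenvectors_linearIndependent' A θ h1 v hv).fintype_card_le_finrank
    rw [Fintype.card_fin] at this
    omega
  have hP0 : P 0 := by
    have : ∃ μ, A.HasEigenvalue μ := by
      by_contra! hne
      have : ⨆ μ : F, A.eigenspace μ = ⊥ := by
        refine iSup_eq_bot.2 fun μ => ?_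
        have := hne μ
        rwa [Module.End.HasEigenvalue, Module.End.HasUnifEigenvalue, not_not] at this
      exact bot_ne_top (this.symm.trans hA)
    obtain ⟨μ, hμ⟩ := this
    exact ⟨fun _ => μ, fun i j _ => by omega, fun _ => hμ, fun i j h => by omega⟩
  obtain ⟨θ, hθ⟩ : P (Nat.findGreatest P (Module.finrank F V)) :=
    Nat.findGreatest_spec (Nat.zero_le _) hP0
  have hmax : ¬ P (Nat.findGreatest P (Module.finrank F V) + 1) := fun h =>
    Nat.findGreatest_is_greatest (Nat.lt_succ_self _) (hbound _ h) h
  generalize Nat.findGreatest P (Module.finrank F V) = d at θ hθ hmax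
  have hmax' (θ' : Fin (d + 1 + 1) → F) : ¬ IsEigenvaluePath q A θ' := fun h => hmax ⟨θ', h⟩
  have htop : ⨆ i, A.eigenspace (θ i) = ⊤ := by
    refine (hirr (⨆ i, A.eigenspace (θ i)) (mem_iSup_of_map_mem fun i x hx => ?_)
      (mem_iSup_of_map_mem fun i x hx => ?_)).resolve_left fun e => ?_
    · rw [Module.End.mem_eigenspace_iff.1 hx]
      exact Submodule.smul_mem _ _ (le_iSup (fun i => A.eigenspace (θ i)) i hx)
    · refine mem_of_dolanGrady hdg hA hq (Module.End.mem_eigenspace_iff.1 hx) fun ν hν hadj => ?_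
      obtain ⟨j, rfl⟩ : ∃ j, θ j = ν := by
        rcases hadj with e | e
        · exact ⟨i, e.symm⟩
        · exact hθ.mem_of_adjacent hmax' hν i e
      exact le_iSup (fun i => A.eigenspace (θ i)) j
    · exact hθ.2.1 0 (iSup_eq_bot.1 e 0)
  refine ⟨d, θ, ⟨hθ.1, fun μ => ⟨fun hμ => ?_, ?_⟩⟩, hθ.2.2⟩
  · by_contra! hne
    have h1 := Module.End.eigenspaces_iSupIndep A μ
    have h2 : (⊤ : Submodule F V) ≤ ⨆ ν, ⨆ _ : ν ≠ μ, A.eigenspace ν := by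
      rw [← htop]
      exact iSup_le fun i =>
        le_iSup₂_of_le (f := fun ν (_ : ν ≠ μ) => A.eigenspace ν) (θ i) (hne i) le_rfl
    rw [top_le_iff.1 h2, disjoint_top] at h1
    exact hμ h1
  · rintro ⟨i, rfl⟩
    exact hθ.2.1 i

/-- If `A` were scalar, any eigenline of `S` would be invariant, forcing dimension one. -/
theorem IsEigenvalueOrdering.pos [FiniteDimensional F V] (hdim : 2 ≤ Module.finrank F V)
    {A S : Module.End F V} (hA : IsDiagonalizable A) (hS : IsDiagonalizable S)
    (hirr : IsIrredPair A S) {θ : Fin (d + 1) → F} (h : IsEigenvalueOrdering A θ) : 0 < d := by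
  rw [Nat.pos_iff_ne_zero]
  rintro rfl
  have hV : Nontrivial V := Module.nontrivial_of_finrank_pos (R := F) (by omega)
  have hscalar (x : V) : A x = θ 0 • x := by
    have h1 := (isDecomposition_iff.1 (h.isDecomposition hA)).2.2
    have h2 : ⨆ i, eigenspaces A θ i ≤ eigenspaces A θ 0 :=
      iSup_le fun i => by rw [show i = 0 by omega]
    rw [h1] at h2
    exact Module.End.mem_eigenspace_iff.1 (h2 (show x ∈ ⊤ from trivial))
  obtain ⟨μ, x, hx⟩ : ∃ μ x, S.HasEigenvector μ x := by
    by_contra! hne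
    have : ⨆ μ : F, S.eigenspace μ = ⊥ := by
      refine iSup_eq_bot.2 fun μ => (Submodule.eq_bot_iff _).2 fun x hx => ?_
      by_contra h0
      exact hne μ x ⟨hx, h0⟩
    exact bot_ne_top (this.symm.trans hS)
  have hx1 := Module.End.mem_eigenspace_iff.1 hx.1
  have hspan (y : V) (hy : y ∈ Submodule.span F {x}) : S y ∈ Submodule.span F {x} := by
    obtain ⟨c, rfl⟩ := Submodule.mem_span_singleton.1 hy
    rw [map_smul, hx1]
    exact Submodule.smul_mem _ _ (Submodule.smul_mem _ _ (Submodule.mem_span_singleton_self x))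
  rcases hirr (Submodule.span F {x})
    (fun y hy => by rw [hscalar]; exact Submodule.smul_mem _ _ hy) hspan with e | e
  · exact hx.2 (Submodule.span_singleton_eq_bot.1 e)
  · have := finrank_span_singleton (K := F) hx.2
    rw [e, finrank_top] at this
    omega

theorem zpow_eq_arrowScalar_inv (q : F) (i : Fin (d + 1)) :
    q ^ (2 * (i : ℤ) - (d : ℤ)) = (arrowScalar d q i)⁻¹ := by
  rw [arrowScalar, ← zpow_neg, neg_sub]

theorem exists_isStandard [FiniteDimensional F V] {q : F} (hq : IsGeneric q)
    (hdim : 2 ≤ Module.finrank F V) {A S : Module.End F V} (hdg : DolanGrady q A S)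
    (hdg' : DolanGrady q S A) (hA : IsDiagonalizable A) (hS : IsDiagonalizable S)
    (hirr : IsIrredPair A S) :
    ∃ (d : ℕ) (θ θs : Fin (d + 1) → F) (a : F), IsStandard q A S d θ θs a := by
  have hV : Nontrivial V := Module.nontrivial_of_finrank_pos (R := F) (by omega)
  obtain ⟨d, θ, h, hadj⟩ := exists_eigenvalueOrdering hq.1 hdg hA hirr
  obtain ⟨e, θs, hs, hadjs⟩ := exists_eigenvalueOrdering hq.1 hdg' hS hirr.symm
  obtain ⟨a, ha, hθ⟩ := exists_racah_parameter hq (h.pos hdim hA hS hirr) h.1 hadj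
  obtain ⟨b, hb, hθs⟩ := exists_racah_parameter hq (hs.pos hdim hS hA hirr.symm) hs.1 hadjs
  have t := isTridiagonal_of_adjacent hq hdg hA h ha hθ
  have ts := isTridiagonal_of_adjacent hq hdg' hS hs hb hθs
  have dec := h.isDecomposition hA
  have decs := hs.isDecomposition hS
  have f := flagScalar_eigenspaces A θ
  have fs := flagScalar_eigenspaces S θs
  obtain rfl : d = e := le_antisymm (le_of_isTridiagonal hirr decs dec fs f ts t)
    (le_of_isTridiagonal hirr.symm dec decs f fs t ts)
  exact ⟨d, θ, θs, a, h, hadj, ha, fun i => by rw [zpow_eq_arrowScalar_inv]; exact hθ i, hs, ts⟩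

/-- The ordering `θs` is assumed only tridiagonal; its adjacency, and hence the parameter `b`, has
to be derived. -/
theorem IsStandard.isRacahPair [FiniteDimensional F V] {q : F} (hq : IsGeneric q)
    (hdim : 2 ≤ Module.finrank F V) {A S : Module.End F V} (hdg : DolanGrady q A S)
    (hdg' : DolanGrady q S A) (hA : IsDiagonalizable A) (hS : IsDiagonalizable S)
    (hirr : IsIrredPair A S) {θ θs : Fin (d + 1) → F} {a : F} (h : IsStandard q A S d θ θs a) :
    ∃ b, IsRacahPair q A S θ θs a b := by
  have hd := h.ordering.pos hdim hA hS hirr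
  have hθ (i : Fin (d + 1)) : θ i = a * arrowScalar d q i + a⁻¹ * (arrowScalar d q i)⁻¹ := by
    rw [h.eigenvalue_eq, zpow_eq_arrowScalar_inv]; rfl
  obtain ⟨b, hb, hθs⟩ := exists_racah_parameter hq hd h.ordering_star.1
    (adjacent_of_isTridiagonal hq.1 hdg' hS hirr h.ordering_star h.tridiagonal)
  exact ⟨b, hdg, hirr, h.a_ne_zero, hb, hθ, hθs, h.ordering.1, h.ordering_star.1,
    h.ordering.isDecomposition hA, h.ordering_star.isDecomposition hS,
    isTridiagonal_of_adjacent hq hdg hA h.ordering h.a_ne_zero hθ, h.tridiagonal⟩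

/-- If `a = a⁻¹`, the eigenvalue sequence is palindromic, so its two ends coincide. -/
theorem IsRacahPair.sub_inv_ne_zero {q : F} {A S : Module.End F V} {θ θs : Fin (d + 1) → F}
    {a b : F} (h : IsRacahPair q A S θ θs a b) (hd : 0 < d) : a - a⁻¹ ≠ 0 := by
  intro e
  have e' : a⁻¹ = a := (sub_eq_zero.1 e).symm
  have : θ (Fin.rev 0) = θ 0 := by
    rw [h.eigenvalue, h.eigenvalue, arrowScalar_rev, e', inv_inv, add_comm]
  have := congrArg Fin.val (h.injective this)
  rw [Fin.val_rev, Fin.val_zero] at this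
  omega

theorem isIrredPair_action {q : F} [Module (Oq F q) V] [IsScalarTower F (Oq F q) V]
    [IsSimpleModule (Oq F q) V] : IsIrredPair (action V (Oq.A q)) (action V (Oq.As q)) := by
  intro U h1 h2
  have hgen (y : FreeAlgebra F Bool) :
      ∀ x ∈ U, (RingQuot.mkAlgHom F (OqRel F q) y) • x ∈ U := by
    induction y using FreeAlgebra.induction with
    | grade0 r =>
      intro x hx
      rw [AlgHom.commutes, algebraMap_smul]
      exact Submodule.smul_mem _ _ hx
    | grade1 b =>
      cases b
      · exact h1
      · exact h2
    | mul y z hy hz =>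
      intro x hx
      rw [map_mul, mul_smul]
      exact hy _ (hz x hx)
    | add y z hy hz =>
      intro x hx
      rw [map_add, add_smul]
      exact add_mem (hy x hx) (hz x hx)
  let W : Submodule (Oq F q) V :=
    { U.toAddSubmonoid with
      smul_mem' := fun c x hx => by
        obtain ⟨y, rfl⟩ := RingQuot.mkAlgHom_surjective F (OqRel F q) c
        exact hgen y x hx }
  have hW (x : V) : x ∈ W ↔ x ∈ U := Iff.rfl
  rcases eq_bot_or_eq_top W with e | e
  · left
    ext x
    rw [← hW, e, Submodule.mem_bot, Submodule.mem_bot]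
  · right
    ext x
    rw [← hW, e]
    exact iff_of_true trivial trivial

theorem DolanGrady.map {R T : Type*} [Ring R] [Algebra F R] [Ring T] [Algebra F T]
    (φ : R →ₐ[F] T) {q : F} {x y : R} (h : DolanGrady q x y) : DolanGrady q (φ x) (φ y) := by
  have := congrArg φ h
  simpa only [DolanGrady, map_lieBr, map_qComm, map_smul] using this

end Standard

end QOnsager

/-! ### The main theorem. -/

open QOnsager
theorem theorem8p3 {F : Type*} [Field F] {q : F} (hq : IsGeneric q)
    {V : Type*} [AddCommGroup V] [Module F V] [Module (Oq F q) V] [IsScalarTower F (Oq F q) V]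
    [FiniteDimensional F V] [IsSimpleModule (Oq F q) V] (hdim : 2 ≤ Module.finrank F V)
    (A As Lm : Module.End F V)
    (A_eq : A = action V (Oq.A q)) (As_eq : As = action V (Oq.As q))
    (Lm_eq : Lm = action V ((Oq.lusztig hq).symm (Oq.As q)))
    (hA : IsDiagonalizable A) (hAs : IsDiagonalizable As) :
    -- the choices can be made
    (∃ (d : ℕ) (θ θs : Fin (d + 1) → F) (a : F), IsStandard q A As d θ θs a) ∧
    -- for all choices, with the eigenspace decompositions `X`, `Xs`, `Xm` of `A`, `A*`, `L⁻¹(A*)`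
    ∀ (d : ℕ) (θ θs : Fin (d + 1) → F) (a : F), IsStandard q A As d θ θs a →
      ∀ X Xs Xm : Fin (d + 1) → Submodule F V,
        X = eigenspaces A θ → Xs = eigenspaces As θs → Xm = eigenspaces Lm θs →
        IsDecomposition X ∧ IsDecomposition Xs ∧ IsDecomposition Xm ∧ a - a⁻¹ ≠ 0 ∧
        -- the edges joining `A*` to `A`
        (∃ K B Kd Bd : Module.End F V, IsSplitMaps q X Xs K B Kd Bd) ∧
        ∀ K B Kd Bd : Module.End F V, IsSplitMaps q X Xs K B Kd Bd →
          -- the edges joining `A` to `L⁻¹(A*)`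
          IsArrow q (a⁻¹ • A - (a ^ 2)⁻¹ • B) X Xm ∧
          IsArrow q (a • A - a ^ 2 • K) (inversion X) Xm ∧
          IsArrow q (a⁻¹ • A - (a ^ 2)⁻¹ • Bd) X (inversion Xm) ∧
          IsArrow q (a • A - a ^ 2 • Kd) (inversion X) (inversion Xm) ∧
          -- the vertical edges joining `A*` to `L⁻¹(A*)`
          IsArrow q ((a - a⁻¹)⁻¹ • (a • K - a⁻¹ • B)) Xs Xm ∧
          IsArrow q ((a - a⁻¹)⁻¹ • (a • Kd - a⁻¹ • Bd)) (inversion Xs) (inversion Xm) := by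
  subst A_eq As_eq Lm_eq
  have hdg := Oq.dolanGrady (q := q).map (Algebra.lsmul F F V)
  have hdg' := Oq.dolanGrady_symm (q := q).map (Algebra.lsmul F F V)
  have hirr := isIrredPair_action (F := F) (V := V) (q := q)
  refine ⟨exists_isStandard hq hdim hdg hdg' hA hAs hirr, ?_⟩
  rintro d θ θs a h X Xs Xm rfl rfl rfl
  obtain ⟨b, h'⟩ := h.isRacahPair hq hdim hdg hdg' hA hAs hirr
  have ha := h'.sub_inv_ne_zero (h.ordering.pos hdim hA hAs hirr)
  have hL : action V ((Oq.lusztig hq).symm (Oq.As q)) =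
      twistElt q⁻¹ (action V (Oq.A q)) (action V (Oq.As q)) := by
    rw [Oq.lusztig_symm_As]
    exact map_twistElt (Algebra.lsmul F F V) _ _ _
  rw [hL]
  -- The four arrows come from one existence statement, applied to the pair and its reversals in
  -- `A`, in `A*` and in both.
  obtain ⟨B, hB⟩ := h'.exists_isArrow hq
  obtain ⟨K, hK⟩ := h'.rev.exists_isArrow hq
  obtain ⟨Bd, hBd⟩ := h'.rev_star.exists_isArrow hq
  obtain ⟨Kd, hKd⟩ := h'.rev.rev_star.exists_isArrow hq
  refine ⟨h'.dec, h'.dec_star, (h'.twist_arrow hq hB).1, ha, ⟨K, B, Kd, Bd, hK, hB, hKd, hBd⟩, ?_⟩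
  rintro K B Kd Bd ⟨hK, hB, hKd, hBd⟩
  exact ⟨(h'.twist_arrow hq hB).2, h'.twist_arrow_rev hq hK, (h'.rev_star.twist_arrow hq hBd).2,
    h'.rev_star.twist_arrow_rev hq hKd, h'.vertical_arrow hq ha hK hB,
    h'.rev_star.vertical_arrow hq ha hKd hBd⟩
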